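/- **Setting.** A correlation is a table $P=\{P(a,b|x,y)\}_{a,b,x,y\in\{0,1\}}$ of real numbers. It is quantum, $P\in\mathcal Q$, if there are complex Hilbert spaces $\mathcal H_A,\mathcal H_B$ (of any dimension), a density operator $\rho$ on $\mathcal H_A\otimes\mathcal H_B$, and for each setting $x$ (resp. $y$) a two-outcome POVM $\{M^A_{a|x}\}_a$ on $\mathcal H_A$ (resp. $\{M^B_{b|y}\}_b$ on $\mathcal H_B$) with $P(a,b|x,y)=\mathrm{tr}[(M^A_{a|x}\otimes M^B_{b|y})\rho]$. Put $$\mathcal S_{\rm CHSH}(P)=\sum_{x,y,a,b=0}^1(-1)^{xy+a+b+1}P(a,b|x,y),$$ $$\mathcal Q_{3b}=\{P\in\mathcal Q: P(0,0|0,0)=P(1,1|0,0)=P(1,0|1,1)=0\}.$$ Let $\tau=\sqrt[3]{17+3\sqrt{33}}$, $\theta=\tan^{-1}\!\big(\tfrac13(-1-\tfrac2\tau+\tau)\big)$, $\alpha=\tan^{-1}\sqrt{\tan\theta}$, $\beta=\tfrac\pi2-\alpha$, and $$\kappa_1=\tfrac12\Big(\tfrac{\tau^2-\tau-2}{3\tau}\Big)^3,\qquad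 \kappa_2=\frac{1-\cos(2\tan^{-1}\sqrt{\tan\theta})}{2\sec^2\theta},\qquad \kappa_3=\frac{1-2\kappa_1-2\kappa_2}{2}.$$ Let $P_Q$ be the correlation given, for each pair of settings, by the block whose rows are indexed by $b=0,1$ and columns by $a=0,1$: $$(x,y)=(0,0):\begin{pmatrix}0&\frac12-\kappa_2\\ \frac12+\kappa_2&0\end{pmatrix},\quad (1,0):\begin{pmatrix}\kappa_1&\kappa_3\\ \frac12&\kappa_2\end{pmatrix},$$ $$(0,1):\begin{pmatrix}\kappa_2&\kappa_3\\ \frac12&\kappa_1\end{pmatrix},\quad (1,1):\begin{pmatrix}\frac12-\kappa_1&0\\ 2\kappa_1&\frac12-\kappa_1\end{pmatrix}.$$ The reference strategy is the two-qubit state $|\widetilde\psi\rangle=\cos\theta|0\rangle|1\rangle+\sin\theta|1\rangle|0\rangle$ with effects $\widetilde{M^A_{a|x}}=\frac{1+(-1)^aA_x}{2}$, $\widetilde{M^B_{b|y}}=\frac{1+(-1)^bB_y}{2}$ for the observables $$A_0=B_0=\sigma_z,\quad A_1=\cos2\alpha\,\sigma_z-\sin2\alpha\,\sigma_x,\quad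 B_1=-\cos2\beta\,\sigma_z-\sin2\beta\,\sigma_x.$$ A strategy consisting of a unit vector $|\psi\rangle\in\mathcal H_A\otimes\mathcal H_B$ and POVMs $M^A_{a|x},M^B_{b|y}$ is *equivalent up to local isometries* to the reference strategy if there are Hilbert spaces $\mathcal H_{A'},\mathcal H_{B'}$, isometries $\Phi_A:\mathcal H_A\to\mathcal H_{A'}\otimes\mathbb C^2$, $\Phi_B:\mathcal H_B\to\mathcal H_{B'}\otimes\mathbb C^2$ and a unit vector $|\varsigma\rangle\in\mathcal H_{A'}\otimes\mathcal H_{B'}$ such that, up to reordering the tensor factors, $$(\Phi_A\otimes\Phi_B)\big(M^A_{a|x}\otimes M^B_{b|y}|\psi\rangle\big)=|\varsigma\rangle\otimes\big(\widetilde{M^A_{a|x}}\otimes\widetilde{M^B_{b|y}}|\widetilde\psi\rangle\big)\quad\text{for all }a,b,x,y.$$ **Theorem.** 1. The maximum of $\mathcal S_{\rm CHSH}$ over $\mathcal Q_{3b}$ exists and equals $4-4(2\kappa_1+\kappa_2)\approx2.26977$ (within $5\cdot10^{-6}$). It is attained at $P_Q\in\mathcal Q_{3b}$ and at no other element of $\mathcal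 Q_{3b}$. 2. $P_Q$ is an extreme point of $\mathcal Q$. 3. $P_Q$ self-tests the reference strategy: the reference strategy realizes $P_Q$, and every strategy (unit vector and POVMs, on Hilbert spaces of any dimension) that realizes $P_Q$ is equivalent to it up to local isometries. 4. Consequently, if a strategy (unit vector and POVMs) yields a correlation with $P(0,0|0,0)=P(1,1|0,0)=P(1,0|1,1)=0$ and $\mathcal S_{\rm CHSH}=4-4(2\kappa_1+\kappa_2)$, then it is equivalent to the reference strategy up to local isometries. -/

import Mathlib

universe u

open scoped TensorProduct InnerProductSpace
open UniformSpace

noncomputable section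

/-! ### Tensor products of Hilbert spaces -/

section Tensor

variable {H K H' K' A B C D : Type*}
  [NormedAddCommGroup H] [InnerProductSpace ℂ H] [NormedAddCommGroup K] [InnerProductSpace ℂ K]
  [NormedAddCommGroup H'] [InnerProductSpace ℂ H'] [NormedAddCommGroup K'] [InnerProductSpace ℂ K']
  [NormedAddCommGroup A] [InnerProductSpace ℂ A] [NormedAddCommGroup B] [InnerProductSpace ℂ B]
  [NormedAddCommGroup C] [InnerProductSpace ℂ C] [NormedAddCommGroup D] [InnerProductSpace ℂ D]

/-- The Hilbert space tensor product: the completion of the algebraic tensor product with respect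
to the inner product `⟪a ⊗ b, a' ⊗ b'⟫ = ⟪a, a'⟫ * ⟪b, b'⟫`. -/
abbrev HilbertTensor (H K : Type*) [NormedAddCommGroup H] [InnerProductSpace ℂ H]
    [NormedAddCommGroup K] [InnerProductSpace ℂ K] : Type _ :=
  Completion (H ⊗[ℂ] K)

/-- The product vector `x ⊗ y`. -/
def prodVec (x : H) (y : K) : HilbertTensor H K := ((x ⊗ₜ[ℂ] y : H ⊗[ℂ] K) : Completion (H ⊗[ℂ] K))

/-- The bounded operator `f ⊗ g` on the Hilbert space tensor product. -/
def tensorOp (f : H →L[ℂ] H') (g : K →L[ℂ] K') : HilbertTensor H K →L[ℂ] HilbertTensor H' K' :=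
  (TensorProduct.mapL f g).completion

theorem tensorOp_prodVec (f : H →L[ℂ] H') (g : K →L[ℂ] K') (x : H) (y : K) :
    tensorOp f g (prodVec x y) = prodVec (f x) (g y) := by
  simp [tensorOp, prodVec]

/-- The isometric rearrangement `(a ⊗ b) ⊗ (c ⊗ d) ↦ (a ⊗ c) ⊗ (b ⊗ d)` on algebraic tensors. -/
def rearrange (A B C D : Type*)
    [NormedAddCommGroup A] [InnerProductSpace ℂ A] [NormedAddCommGroup B] [InnerProductSpace ℂ B]
    [NormedAddCommGroup C] [InnerProductSpace ℂ C] [NormedAddCommGroup D] [InnerProductSpace ℂ D] :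
    (A ⊗[ℂ] B) ⊗[ℂ] (C ⊗[ℂ] D) ≃ₗᵢ[ℂ] (A ⊗[ℂ] C) ⊗[ℂ] (B ⊗[ℂ] D) :=
  (TensorProduct.assocIsometry ℂ A B (C ⊗[ℂ] D)).trans <|
  (((((TensorProduct.assocIsometry ℂ B C D).symm.trans
    ((TensorProduct.commIsometry ℂ B C).rTensor D)).trans
    (TensorProduct.assocIsometry ℂ C B D))).lTensor A).trans <|
  (TensorProduct.assocIsometry ℂ A C (B ⊗[ℂ] D)).symm

/-- `rearrange` with values in the Hilbert space tensor product of Hilbert space tensor products. -/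
def rearrangeL (A B C D : Type*)
    [NormedAddCommGroup A] [InnerProductSpace ℂ A] [NormedAddCommGroup B] [InnerProductSpace ℂ B]
    [NormedAddCommGroup C] [InnerProductSpace ℂ C] [NormedAddCommGroup D] [InnerProductSpace ℂ D] :
    (A ⊗[ℂ] B) ⊗[ℂ] (C ⊗[ℂ] D) →L[ℂ] HilbertTensor (HilbertTensor A C) (HilbertTensor B D) :=
  Completion.toComplL ∘L
    TensorProduct.mapL (Completion.toComplL : A ⊗[ℂ] C →L[ℂ] HilbertTensor A C)
      (Completion.toComplL : B ⊗[ℂ] D →L[ℂ] HilbertTensor B D) ∘L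
    (rearrange A B C D).toContinuousLinearEquiv.toContinuousLinearMap

/-- For `ς ∈ A ⊗ B` and `w ∈ C ⊗ D`, the vector `ς ⊗ w` regarded as an element of
`(A ⊗ C) ⊗ (B ⊗ D)`: the continuous bilinear map with
`(a ⊗ b, c ⊗ d) ↦ (a ⊗ c) ⊗ (b ⊗ d)`. -/
def junkTensor : HilbertTensor A B →L[ℂ] HilbertTensor C D →L[ℂ]
    HilbertTensor (HilbertTensor A C) (HilbertTensor B D) :=
  ((((ContinuousLinearMap.compL ℂ _ _ _ (rearrangeL A B C D)) ∘L
    TensorProduct.mkL ℂ (A ⊗[ℂ] B) (C ⊗[ℂ] D)).fromCompletion).flip.fromCompletion).flip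

theorem junkTensor_prodVec (a : A) (b : B) (c : C) (d : D) :
    junkTensor (prodVec a b) (prodVec c d) = prodVec (prodVec a c) (prodVec b d) := by
  simp [junkTensor, prodVec, rearrangeL, rearrange]
  rfl

end Tensor

/-! ### Correlations and quantum strategies -/

/-- A table `P a b x y = P(a,b|x,y)` of real numbers in the two-setting, two-outcome scenario. -/
abbrev Correlation : Type := Fin 2 → Fin 2 → Fin 2 → Fin 2 → ℝ

/-- A two-outcome positive operator-valued measure. -/
structure IsPOVM {H : Type*} [NormedAddCommGroup H] [InnerProductSpace ℂ H]
    (M : Fin 2 → (H →L[ℂ] H)) : Prop where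
  positive : ∀ a, (M a).IsPositive
  sum_eq_one : ∑ a, M a = 1

/-- `T` has trace `t`: its diagonal matrix elements sum to `t` in every Hilbert basis. -/
def HasTrace {H : Type u} [NormedAddCommGroup H] [InnerProductSpace ℂ H]
    (T : H →L[ℂ] H) (t : ℂ) : Prop :=
  ∀ (ι : Type u) (e : HilbertBasis ι ℂ H), HasSum (fun i => ⟪e i, T (e i)⟫_ℂ) t

/-- Density operators: positive operators of trace one. -/
structure IsDensityOperator {H : Type u} [NormedAddCommGroup H] [InnerProductSpace ℂ H]
    (ρ : H →L[ℂ] H) : Prop where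
  positive : ρ.IsPositive
  trace_eq_one : HasTrace ρ 1

/-- The set of quantum correlations: `P(a,b|x,y) = tr[(M_{a|x} ⊗ N_{b|y}) ρ]` for a density
operator on a tensor product of two complex Hilbert spaces of any dimension, and local POVMs. -/
def quantumSet : Set Correlation :=
  {P | ∃ (HA HB : Type u) (_ : NormedAddCommGroup HA) (_ : InnerProductSpace ℂ HA)
      (_ : CompleteSpace HA) (_ : NormedAddCommGroup HB) (_ : InnerProductSpace ℂ HB)
      (_ : CompleteSpace HB)
      (ρ : HilbertTensor HA HB →L[ℂ] HilbertTensor HA HB)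
      (M : Fin 2 → Fin 2 → (HA →L[ℂ] HA)) (N : Fin 2 → Fin 2 → (HB →L[ℂ] HB)),
      IsDensityOperator ρ ∧ (∀ x, IsPOVM (M x)) ∧ (∀ y, IsPOVM (N y)) ∧
      ∀ a b x y, HasTrace (tensorOp (M x a) (N y b) ∘L ρ) (P a b x y : ℂ)}

/-- The data of a pure-state strategy; `measA x a` and `measB y b` are the effects of Alice's
outcome `a` for setting `x` and of Bob's outcome `b` for setting `y`. -/
structure PureStrategy (HA HB : Type*) [NormedAddCommGroup HA] [InnerProductSpace ℂ HA]
    [NormedAddCommGroup HB] [InnerProductSpace ℂ HB] where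
  state : HilbertTensor HA HB
  measA : Fin 2 → Fin 2 → (HA →L[ℂ] HA)
  measB : Fin 2 → Fin 2 → (HB →L[ℂ] HB)

/-- `S` is a valid strategy (normalized state, POVMs) and yields the correlation `P`. -/
structure PureStrategy.Realizes {HA HB : Type*} [NormedAddCommGroup HA] [InnerProductSpace ℂ HA]
    [NormedAddCommGroup HB] [InnerProductSpace ℂ HB] (S : PureStrategy HA HB)
    (P : Correlation) : Prop where
  norm_state : ‖S.state‖ = 1
  povmA : ∀ x, IsPOVM (S.measA x)
  povmB : ∀ y, IsPOVM (S.measB y)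
  born : ∀ a b x y,
    (P a b x y : ℂ) = ⟪S.state, tensorOp (S.measA x a) (S.measB y b) S.state⟫_ℂ

/-- `S` is equivalent to the reference strategy `R` up to local isometries
`ΦA : HA → HA' ⊗ KA`, `ΦB : HB → HB' ⊗ KB` and a normalized auxiliary state on `HA' ⊗ HB'`. -/
def PureStrategy.EquivUpToLocalIsometries {HA HB : Type u} {KA KB : Type}
    [NormedAddCommGroup HA] [InnerProductSpace ℂ HA]
    [NormedAddCommGroup HB] [InnerProductSpace ℂ HB]
    [NormedAddCommGroup KA] [InnerProductSpace ℂ KA]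
    [NormedAddCommGroup KB] [InnerProductSpace ℂ KB]
    (S : PureStrategy HA HB) (R : PureStrategy KA KB) : Prop :=
  ∃ (HA' HB' : Type u) (_ : NormedAddCommGroup HA') (_ : InnerProductSpace ℂ HA')
    (_ : CompleteSpace HA') (_ : NormedAddCommGroup HB') (_ : InnerProductSpace ℂ HB')
    (_ : CompleteSpace HB')
    (ΦA : HA →ₗᵢ[ℂ] HilbertTensor HA' KA) (ΦB : HB →ₗᵢ[ℂ] HilbertTensor HB' KB)
    (ς : HilbertTensor HA' HB'), ‖ς‖ = 1 ∧
    ∀ a b x y,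
      tensorOp ΦA.toContinuousLinearMap ΦB.toContinuousLinearMap
          (tensorOp (S.measA x a) (S.measB y b) S.state) =
        junkTensor ς (tensorOp (R.measA x a) (R.measB y b) R.state)

/-- `P` self-tests the reference strategy `R`: `R` realizes `P`, and every pure-state strategy
realizing `P`, on Hilbert spaces of any dimension, is equivalent to `R` up to local isometries. -/
def SelfTests {KA KB : Type} [NormedAddCommGroup KA] [InnerProductSpace ℂ KA]
    [NormedAddCommGroup KB] [InnerProductSpace ℂ KB]
    (P : Correlation) (R : PureStrategy KA KB) : Prop :=
  R.Realizes P ∧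
  ∀ (HA HB : Type u) [NormedAddCommGroup HA] [InnerProductSpace ℂ HA] [CompleteSpace HA]
    [NormedAddCommGroup HB] [InnerProductSpace ℂ HB] [CompleteSpace HB]
    (S : PureStrategy HA HB), S.Realizes P → S.EquivUpToLocalIsometries R

/-! ### The CHSH value and Class 3b -/

/-- The CHSH value `∑ (-1)^(xy+a+b+1) P(a,b|x,y)`. -/
def chsh (P : Correlation) : ℝ :=
  ∑ x : Fin 2, ∑ y : Fin 2, ∑ a : Fin 2, ∑ b : Fin 2,
    (-1 : ℝ) ^ ((x : ℕ) * (y : ℕ) + (a : ℕ) + (b : ℕ) + 1) * P a b x y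

/-- The zeros `P(0,0|0,0) = P(1,1|0,0) = P(1,0|1,1) = 0`. -/
def HasClass3bZeros (P : Correlation) : Prop :=
  P 0 0 0 0 = 0 ∧ P 1 1 0 0 = 0 ∧ P 1 0 1 1 = 0

/-- The quantum correlations with the zeros of Class 3b. -/
def quantumClass3b : Set Correlation := {P | P ∈ quantumSet.{u} ∧ HasClass3bZeros P}

/-! ### The correlation `P_Q` and the reference strategy -/

namespace Class3b

/-- `τ = ∛(17 + 3√33)`. -/
def τ : ℝ := (17 + 3 * √33) ^ (1 / 3 : ℝ)

def θ : ℝ := Real.arctan (1 / 3 * (-1 - 2 / τ + τ))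

def α : ℝ := Real.arctan √(Real.tan θ)

def β : ℝ := Real.pi / 2 - α

def κ₁ : ℝ := 1 / 2 * ((τ ^ 2 - τ - 2) / (3 * τ)) ^ 3

/-- `κ₂ = (1 - cos (2 arctan √(tan θ))) / (2 sec² θ)`. -/
def κ₂ : ℝ := (1 - Real.cos (2 * Real.arctan √(Real.tan θ))) / (2 * (1 / Real.cos θ) ^ 2)

def κ₃ : ℝ := (1 - 2 * κ₁ - 2 * κ₂) / 2

/-- The correlation `P_Q`, one block per pair of settings `x`, `y`; in each block the rows are
indexed by Bob's outcome `b` and the columns by Alice's outcome `a`. -/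
def PQ : Correlation := fun a b x y =>
  match x, y with
  | 0, 0 => !![0, 1 / 2 - κ₂;
               1 / 2 + κ₂, 0] b a
  | 1, 0 => !![κ₁, κ₃;
               1 / 2, κ₂] b a
  | 0, 1 => !![κ₂, κ₃;
               1 / 2, κ₁] b a
  | 1, 1 => !![1 / 2 - κ₁, 0;
               2 * κ₁, 1 / 2 - κ₁] b a

/-- `4 - 4 (2 κ₁ + κ₂)`. -/
def maxCHSH : ℝ := 4 - 4 * (2 * κ₁ + κ₂)

/-- The space `ℂ²` of a qubit. -/
abbrev Qubit : Type := EuclideanSpace ℂ (Fin 2)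

/-- The computational basis vectors `|0⟩` and `|1⟩`. -/
def ket (i : Fin 2) : Qubit := EuclideanSpace.single i 1

def σz : Matrix (Fin 2) (Fin 2) ℂ := !![1, 0; 0, -1]

def σx : Matrix (Fin 2) (Fin 2) ℂ := !![0, 1; 1, 0]

/-- The observable `c σ_z + s σ_x`. -/
def observable (c s : ℝ) : Matrix (Fin 2) (Fin 2) ℂ := (c : ℂ) • σz + (s : ℂ) • σx

/-- The effect `(1 + (-1)^a O) / 2` of outcome `a` for the observable `O`. -/
def effect (O : Matrix (Fin 2) (Fin 2) ℂ) (a : Fin 2) : Qubit →L[ℂ] Qubit :=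
  Matrix.toEuclideanCLM (n := Fin 2) (𝕜 := ℂ) ((1 / 2 : ℂ) • (1 + (-1 : ℂ) ^ (a : ℕ) • O))

/-- Alice's observables `A₀ = σ_z`, `A₁ = cos 2α σ_z - sin 2α σ_x`. -/
def obsA : Fin 2 → Matrix (Fin 2) (Fin 2) ℂ :=
  ![σz, observable (Real.cos (2 * α)) (-Real.sin (2 * α))]

/-- Bob's observables `B₀ = σ_z`, `B₁ = -cos 2β σ_z - sin 2β σ_x`. -/
def obsB : Fin 2 → Matrix (Fin 2) (Fin 2) ℂ :=
  ![σz, observable (-Real.cos (2 * β)) (-Real.sin (2 * β))]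

/-- The reference strategy: the state `cos θ |0⟩|1⟩ + sin θ |1⟩|0⟩` measured with the observables
`obsA` and `obsB`. -/
def reference : PureStrategy Qubit Qubit where
  state := (Real.cos θ : ℂ) • prodVec (ket 0) (ket 1) + (Real.sin θ : ℂ) • prodVec (ket 1) (ket 0)
  measA x a := effect (obsA x) a
  measB y b := effect (obsB y) b

end Class3b

end

/-!
Let `E`, `Q` be the effects of Alice's outcomes `0` for `x = 0` and `1` for `x = 1`, let `E'`, `R`
be the effects of Bob's outcomes `1` for `y = 0` and `0` for `y = 1`, amplified to the joint Hilbert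
space, so that Alice's effects commute with Bob's, and let `ψ` be a vector in this space. The three
zeros of Class 3b say `E (1 - E') ψ = 0`, `(1 - E) E' ψ = 0` and `Q R ψ = 0` (`HardyConfig`). Then
`E ψ = E' ψ`, and with `ψ₁ = (1 - E) ψ` the CHSH value of a unit vector is
`2 + 4 (⟨ψ₁, Q ψ₁⟩ + ⟨ψ₁, R ψ₁⟩ - ‖ψ₁‖²)` (`chsh_opCorrelation`), so that a Hardy-type functional
has to be bounded.

Effects need not be projections, and instead of dilating them the bound is proved in place. With
`X = (1 - E) Q (1 - E)`, `Y = (1 - E') R (1 - E')` and `p` the root of `2 p³ - 2 p² + 2 p = 1`, the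
deficit of the functional is a sum of three terms (`deficit_eq`). The first one is a squared norm.
The second one is nonnegative because the off-diagonal part `u = E Q (1 - E)` satisfies
`u* u ≤ X - X²` (`compression_bounds`). The third one is the expectation of a polynomial in the
commuting operators `X`, `Y`, which is nonnegative on the unit square by a weighted sum of squares
(`hardyPoly_nonneg_of_cone`). This yields the maximum (`hardy_bound`).

If the bound is attained, all three terms vanish. Hence `X ψ₁ = Y ψ₁ = p ψ₁`, `Q² ψ₁ = Q ψ₁`,
`R² ψ₁ = R ψ₁`, and `E ψ` is a multiple of `E E' Q R ψ₁` (`rigidity`). These relations determine all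
probabilities (`opCorrelation_eq_of_chsh_eq`). A density operator is a possibly infinite mixture of
vector states (`IsDensityOperator.exists_decomposition`), which must all have the required zeros and
be optimal if the mixture is; hence the maximum and its uniqueness hold on the whole quantum set.
Extremality follows from uniqueness, because the zeros and the optimality of `PQ` are inherited by
the parts of any convex decomposition.

For self-testing, let `Pi` be the projection onto the common kernel of the operators `E`,
`Q - E Q - p` and `Q² - Q` of Alice. Slicing with vectors of the other party shows that `Pi ⊗ 1`
fixes `ψ₁` (`ampLeft_apply_eq_self`). The operator `U = (p (1 - p))^(-1/2) E Q Pi` is a partial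
isometry whose range is orthogonal to that of `Pi`, and on the ranges of `Pi` and `U` the effects
`E` and `Q` act as the reference effects on a qubit (`ExtractsQubit`). Extending `Pi v ↦ Pi v ⊗ k₁`,
`U v ↦ Pi v ⊗ k₀` to an isometry, and likewise for Bob, turns the state
`ψ = sin θ ς - cos θ (U ⊗ U') ς` into `ς` tensored with the reference state. The reference strategy
itself is never evaluated entry by entry: it has the three zeros and the maximal value, which
determines its correlation (`QubitAction.opCorrelation_eq`).
-/

/-! ### Positive operators on a Hilbert space -/

section Positive

variable {H : Type*} [NormedAddCommGroup H] [InnerProductSpace ℂ H]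

theorem re_inner_nonneg_of_opNonneg {T : H →L[ℂ] H} (hT : 0 ≤ T) (v : H) :
    0 ≤ (⟪v, T v⟫_ℂ).re :=
  ((ContinuousLinearMap.nonneg_iff_isPositive T).1 hT).re_inner_nonneg_right v

variable [CompleteSpace H]

theorem opNonneg_iff_exists_star_mul_self {T : H →L[ℂ] H} : 0 ≤ T ↔ ∃ S, T = star S * S :=
  CStarAlgebra.nonneg_iff_eq_star_mul_self

theorem opNonneg_mul_of_commute {S T : H →L[ℂ] H} (hS : 0 ≤ S) (hT : 0 ≤ T) (h : Commute S T) :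
    0 ≤ S * T :=
  h.mul_nonneg hS hT

/-- A positive operator kills every vector on which its expectation vanishes. -/
theorem apply_eq_zero_of_opNonneg {T : H →L[ℂ] H} (hT : 0 ≤ T) {v : H}
    (hv : (⟪v, T v⟫_ℂ).re = 0) : T v = 0 := by
  obtain ⟨S, rfl⟩ := opNonneg_iff_exists_star_mul_self.1 hT
  have h : (⟪v, (star S * S) v⟫_ℂ).re = ‖S v‖ ^ 2 := by
    rw [mul_apply_eq_comp, ContinuousLinearMap.star_eq_adjoint,
      ContinuousLinearMap.adjoint_inner_right, ← inner_self_eq_norm_sq (𝕜 := ℂ)]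
    rfl
  rw [h, sq_eq_zero_iff, norm_eq_zero] at hv
  rw [mul_apply_eq_comp, hv, map_zero]

end Positive

/-! ### Operators on Hilbert space tensor products -/

section TensorOp

variable {H K H' K' H'' K'' : Type*}
  [NormedAddCommGroup H] [InnerProductSpace ℂ H] [NormedAddCommGroup K] [InnerProductSpace ℂ K]
  [NormedAddCommGroup H'] [InnerProductSpace ℂ H'] [NormedAddCommGroup K'] [InnerProductSpace ℂ K']
  [NormedAddCommGroup H''] [InnerProductSpace ℂ H'']
  [NormedAddCommGroup K''] [InnerProductSpace ℂ K'']

/-- Product vectors span a dense subspace, so they determine bounded operators. -/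
theorem hilbertTensor_ext {G : Type*} [NormedAddCommGroup G] [NormedSpace ℂ G]
    {S T : HilbertTensor H K →L[ℂ] G} (h : ∀ x y, S (prodVec x y) = T (prodVec x y)) : S = T := by
  ext v
  induction v using Completion.induction_on with
  | hp => exact isClosed_eq S.continuous T.continuous
  | ih z =>
    induction z with
    | zero => rw [Completion.coe_zero, map_zero, map_zero]
    | tmul x y => exact h x y
    | add a b ha hb => rw [Completion.coe_add, map_add, map_add, ha, hb]

theorem inner_prodVec (x x' : H) (y y' : K) :
    ⟪prodVec x y, prodVec x' y'⟫_ℂ = ⟪x, x'⟫_ℂ * ⟪y, y'⟫_ℂ := by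
  rw [prodVec, prodVec, Completion.inner_coe, TensorProduct.inner_tmul]

theorem hilbertTensor_ext_inner {v w : HilbertTensor H K}
    (h : ∀ x y, ⟪v, prodVec x y⟫_ℂ = ⟪w, prodVec x y⟫_ℂ) : v = w := by
  have : innerSL ℂ v = innerSL ℂ w := hilbertTensor_ext (by simpa using h)
  exact ext_inner_right ℂ fun z => by simpa using congrArg (fun L => L z) this

/-- The bounded linear map `x ↦ x ⊗ y`. -/
noncomputable def prodVecRight (y : K) : H →L[ℂ] HilbertTensor H K :=
  Completion.toComplL ∘L (TensorProduct.mkL ℂ H K).flip y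

/-- The bounded linear map `y ↦ x ⊗ y`. -/
noncomputable def prodVecLeft (x : H) : K →L[ℂ] HilbertTensor H K :=
  Completion.toComplL ∘L TensorProduct.mkL ℂ H K x

@[simp] theorem prodVecRight_apply (x : H) (y : K) : prodVecRight y x = prodVec x y := rfl

@[simp] theorem prodVecLeft_apply (x : H) (y : K) : prodVecLeft x y = prodVec x y := rfl

theorem prodVec_add_left (x x' : H) (y : K) :
    prodVec (x + x') y = prodVec x y + prodVec x' y := map_add (prodVecRight y) x x'

theorem prodVec_add_right (x : H) (y y' : K) :
    prodVec x (y + y') = prodVec x y + prodVec x y' := map_add (prodVecLeft x) y y'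

theorem prodVec_smul_left (c : ℂ) (x : H) (y : K) :
    prodVec (c • x) y = c • prodVec x y := map_smul (prodVecRight y) c x

theorem prodVec_smul_right (c : ℂ) (x : H) (y : K) :
    prodVec x (c • y) = c • prodVec x y := map_smul (prodVecLeft x) c y

theorem prodVec_zero_left (y : K) : prodVec (0 : H) y = 0 := map_zero (prodVecRight y)

theorem prodVec_zero_right (x : H) : prodVec x (0 : K) = 0 := map_zero (prodVecLeft x)

theorem tensorOp_comp (f : H →L[ℂ] H') (g : K →L[ℂ] K') (f' : H' →L[ℂ] H'') (g' : K' →L[ℂ] K'') :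
    tensorOp f' g' ∘L tensorOp f g = tensorOp (f' ∘L f) (g' ∘L g) :=
  hilbertTensor_ext fun x y => by simp [tensorOp_prodVec]

theorem tensorOp_tensorOp (f : H →L[ℂ] H') (g : K →L[ℂ] K') (f' : H' →L[ℂ] H'')
    (g' : K' →L[ℂ] K'') (v : HilbertTensor H K) :
    tensorOp f' g' (tensorOp f g v) = tensorOp (f' ∘L f) (g' ∘L g) v := by
  rw [← tensorOp_comp]; rfl

theorem tensorOp_mul (f f' : H →L[ℂ] H) (g g' : K →L[ℂ] K) :
    tensorOp (f * f') (g * g') = tensorOp f g * tensorOp f' g' :=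
  (tensorOp_comp f' g' f g).symm

theorem tensorOp_one : tensorOp (1 : H →L[ℂ] H) (1 : K →L[ℂ] K) = 1 :=
  hilbertTensor_ext fun x y => by simp [tensorOp_prodVec]

theorem tensorOp_add_left (f f' : H →L[ℂ] H') (g : K →L[ℂ] K') :
    tensorOp (f + f') g = tensorOp f g + tensorOp f' g :=
  hilbertTensor_ext fun x y => by simp [tensorOp_prodVec, prodVec_add_left]

theorem tensorOp_add_right (f : H →L[ℂ] H') (g g' : K →L[ℂ] K') :
    tensorOp f (g + g') = tensorOp f g + tensorOp f g' :=
  hilbertTensor_ext fun x y => by simp [tensorOp_prodVec, prodVec_add_right]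

theorem tensorOp_smul_left (c : ℂ) (f : H →L[ℂ] H') (g : K →L[ℂ] K') :
    tensorOp (c • f) g = c • tensorOp f g :=
  hilbertTensor_ext fun x y => by simp [tensorOp_prodVec, prodVec_smul_left]

theorem tensorOp_smul_right (c : ℂ) (f : H →L[ℂ] H') (g : K →L[ℂ] K') :
    tensorOp f (c • g) = c • tensorOp f g :=
  hilbertTensor_ext fun x y => by simp [tensorOp_prodVec, prodVec_smul_right]

theorem tensorOp_sub_left (f f' : H →L[ℂ] H') (g : K →L[ℂ] K') :
    tensorOp (f - f') g = tensorOp f g - tensorOp f' g := by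
  rw [eq_sub_iff_add_eq, ← tensorOp_add_left, sub_add_cancel]

theorem tensorOp_sub_right (f : H →L[ℂ] H') (g g' : K →L[ℂ] K') :
    tensorOp f (g - g') = tensorOp f g - tensorOp f g' := by
  rw [eq_sub_iff_add_eq, ← tensorOp_add_right, sub_add_cancel]

theorem tensorOp_zero_left (g : K →L[ℂ] K') : tensorOp (0 : H →L[ℂ] H') g = 0 := by
  rw [← sub_self (0 : H →L[ℂ] H'), tensorOp_sub_left, sub_self]

theorem tensorOp_zero_right (f : H →L[ℂ] H') : tensorOp f (0 : K →L[ℂ] K') = 0 := by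
  rw [← sub_self (0 : K →L[ℂ] K'), tensorOp_sub_right, sub_self]

theorem tensorOp_prodVecRight (k : H') (l : K') (ς : HilbertTensor H K) :
    tensorOp (prodVecRight k) (prodVecRight l) ς = junkTensor ς (prodVec k l) := by
  have : tensorOp (prodVecRight k) (prodVecRight l) =
      (junkTensor (A := H) (B := K)).flip (prodVec k l) :=
    hilbertTensor_ext fun x y => by simp [tensorOp_prodVec, junkTensor_prodVec]
  rw [this, ContinuousLinearMap.flip_apply]

theorem adjoint_tensorOp [CompleteSpace H] [CompleteSpace K] [CompleteSpace H'] [CompleteSpace K']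
    (f : H →L[ℂ] H') (g : K →L[ℂ] K') :
    ContinuousLinearMap.adjoint (tensorOp f g) =
      tensorOp (ContinuousLinearMap.adjoint f) (ContinuousLinearMap.adjoint g) := by
  refine hilbertTensor_ext fun x y => hilbertTensor_ext_inner fun x' y' => ?_
  rw [ContinuousLinearMap.adjoint_inner_left, tensorOp_prodVec, tensorOp_prodVec, inner_prodVec,
    inner_prodVec, ContinuousLinearMap.adjoint_inner_left, ContinuousLinearMap.adjoint_inner_left]

/-- `f ⊗ 1`, as a ring homomorphism. -/
noncomputable def ampLeft (H K : Type*) [NormedAddCommGroup H] [InnerProductSpace ℂ H]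
    [NormedAddCommGroup K] [InnerProductSpace ℂ K] [CompleteSpace H] [CompleteSpace K] :
    (H →L[ℂ] H) →+* (HilbertTensor H K →L[ℂ] HilbertTensor H K) where
  toFun f := tensorOp f 1
  map_one' := tensorOp_one
  map_mul' f f' := by rw [← tensorOp_mul, one_mul]
  map_zero' := tensorOp_zero_left _
  map_add' f g := tensorOp_add_left f g 1

/-- `1 ⊗ g`, as a ring homomorphism. -/
noncomputable def ampRight (H K : Type*) [NormedAddCommGroup H] [InnerProductSpace ℂ H]
    [NormedAddCommGroup K] [InnerProductSpace ℂ K] [CompleteSpace H] [CompleteSpace K] :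
    (K →L[ℂ] K) →+* (HilbertTensor H K →L[ℂ] HilbertTensor H K) where
  toFun g := tensorOp 1 g
  map_one' := tensorOp_one
  map_mul' g g' := by rw [← tensorOp_mul, one_mul]
  map_zero' := tensorOp_zero_right _
  map_add' f g := tensorOp_add_right 1 f g

variable [CompleteSpace H] [CompleteSpace K]

theorem ampLeft_apply (f : H →L[ℂ] H) : ampLeft H K f = tensorOp f 1 := rfl

theorem ampRight_apply (g : K →L[ℂ] K) : ampRight H K g = tensorOp 1 g := rfl

theorem star_ampLeft (f : H →L[ℂ] H) : star (ampLeft H K f) = ampLeft H K (star f) := by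
  rw [ContinuousLinearMap.star_eq_adjoint, ContinuousLinearMap.star_eq_adjoint, ampLeft_apply,
    adjoint_tensorOp, ← ContinuousLinearMap.star_eq_adjoint (1 : K →L[ℂ] K), star_one,
    ampLeft_apply]

theorem star_ampRight (g : K →L[ℂ] K) : star (ampRight H K g) = ampRight H K (star g) := by
  rw [ContinuousLinearMap.star_eq_adjoint, ContinuousLinearMap.star_eq_adjoint, ampRight_apply,
    adjoint_tensorOp, ← ContinuousLinearMap.star_eq_adjoint (1 : H →L[ℂ] H), star_one,
    ampRight_apply]

theorem ampLeft_mul_ampRight (f : H →L[ℂ] H) (g : K →L[ℂ] K) :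
    ampLeft H K f * ampRight H K g = tensorOp f g := by
  rw [ampLeft_apply, ampRight_apply, ← tensorOp_mul, one_mul, mul_one]

theorem commute_ampLeft_ampRight (f : H →L[ℂ] H) (g : K →L[ℂ] K) :
    Commute (ampLeft H K f) (ampRight H K g) := by
  rw [commute_iff_eq, ampLeft_apply, ampRight_apply, ← tensorOp_mul, ← tensorOp_mul, one_mul,
    mul_one, one_mul, mul_one]

theorem ampLeft_nonneg {f : H →L[ℂ] H} (hf : 0 ≤ f) : 0 ≤ ampLeft H K f := by
  rw [opNonneg_iff_exists_star_mul_self] at hf ⊢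
  obtain ⟨g, rfl⟩ := hf
  exact ⟨ampLeft H K g, by rw [map_mul, star_ampLeft]⟩

theorem ampRight_nonneg {g : K →L[ℂ] K} (hg : 0 ≤ g) : 0 ≤ ampRight H K g := by
  rw [opNonneg_iff_exists_star_mul_self] at hg ⊢
  obtain ⟨f, rfl⟩ := hg
  exact ⟨ampRight H K f, by rw [map_mul, star_ampRight]⟩

theorem tensorOp_nonneg {f : H →L[ℂ] H} {g : K →L[ℂ] K} (hf : 0 ≤ f) (hg : 0 ≤ g) :
    0 ≤ tensorOp f g := by
  rw [← ampLeft_mul_ampRight]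
  exact opNonneg_mul_of_commute (ampLeft_nonneg hf) (ampRight_nonneg hg)
    (commute_ampLeft_ampRight f g)

/-- If `Pi` fixes every common zero of the operators `T i`, then `Pi ⊗ 1` fixes every common zero of
the operators `T i ⊗ 1`: the slices `(1 ⊗ ⟨y|) v` of such a zero `v` are common zeros of
the `T i`. -/
theorem ampLeft_apply_eq_self {ι : Type*} {T : ι → H →L[ℂ] H} {Pi : H →L[ℂ] H}
    (hP : ∀ x, (∀ i, T i x = 0) → Pi x = x) {v : HilbertTensor H K}
    (hv : ∀ i, ampLeft H K (T i) v = 0) : ampLeft H K Pi v = v := by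
  have slice (f : H →L[ℂ] H) (y : K) (w : HilbertTensor H K) :
      ContinuousLinearMap.adjoint (prodVecRight y) (ampLeft H K f w) =
        f (ContinuousLinearMap.adjoint (prodVecRight y) w) := by
    refine ext_inner_right ℂ fun x => ?_
    rw [ContinuousLinearMap.adjoint_inner_left, ← ContinuousLinearMap.adjoint_inner_right f,
      ContinuousLinearMap.adjoint_inner_left, ampLeft_apply,
      ← ContinuousLinearMap.adjoint_inner_right, adjoint_tensorOp, prodVecRight_apply,
      tensorOp_prodVec, ← ContinuousLinearMap.star_eq_adjoint (1 : K →L[ℂ] K), star_one]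
    rfl
  refine hilbertTensor_ext_inner fun x y => ?_
  rw [← prodVecRight_apply, ← ContinuousLinearMap.adjoint_inner_left,
    ← ContinuousLinearMap.adjoint_inner_left, slice, hP]
  intro i
  rw [← slice, hv, map_zero]

theorem ampRight_apply_eq_self {ι : Type*} {T : ι → K →L[ℂ] K} {Pi : K →L[ℂ] K}
    (hP : ∀ x, (∀ i, T i x = 0) → Pi x = x) {v : HilbertTensor H K}
    (hv : ∀ i, ampRight H K (T i) v = 0) : ampRight H K Pi v = v := by
  have slice (f : K →L[ℂ] K) (x : H) (w : HilbertTensor H K) :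
      ContinuousLinearMap.adjoint (prodVecLeft x) (ampRight H K f w) =
        f (ContinuousLinearMap.adjoint (prodVecLeft x) w) := by
    refine ext_inner_right ℂ fun y => ?_
    rw [ContinuousLinearMap.adjoint_inner_left, ← ContinuousLinearMap.adjoint_inner_right f,
      ContinuousLinearMap.adjoint_inner_left, ampRight_apply,
      ← ContinuousLinearMap.adjoint_inner_right, adjoint_tensorOp, prodVecLeft_apply,
      tensorOp_prodVec, ← ContinuousLinearMap.star_eq_adjoint (1 : H →L[ℂ] H), star_one]
    rfl
  refine hilbertTensor_ext_inner fun x y => ?_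
  rw [← prodVecLeft_apply, ← ContinuousLinearMap.adjoint_inner_left,
    ← ContinuousLinearMap.adjoint_inner_left, slice, hP]
  intro i
  rw [← slice, hv, map_zero]

end TensorOp

/-! ### The two-variable polynomial inequality -/

/-- The polynomial
`q⁴ + p q (1 - x) (1 - y) + (2 q² - p q) x y - x y (1 - x) (1 - y)`, `q = 1 - p`. -/
def hardyPoly {S : Type*} [Ring S] (p x y : S) : S :=
  (1 - p) ^ 4 + p * (1 - p) * ((1 - x) * (1 - y)) +
    (2 * (1 - p) ^ 2 - p * (1 - p)) * (x * y) - x * y * ((1 - x) * (1 - y))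

theorem cubic_bounds {p : ℝ} (hp : 2 * p ^ 3 - 2 * p ^ 2 + 2 * p = 1) :
    0.6477 < p ∧ p < 0.6479 := by
  constructor <;> nlinarith [sq_nonneg (p - 1 / 3), sq_nonneg (p + 0.6478 / 2 - 1 / 2)]

/-- A weighted sum-of-squares certificate on the unit square: modulo the cubic equation of `p`,
with `d = x - y` and `σ = x + y - 2 p`, the polynomial `4 * hardyPoly p x y` equals
`d² T + σ² (4 p q - T)` where `T = (x - q) (y - q) + 2 q (p - q)`. Since `T` is slightly negative
near the corners `(0, 1)` and `(1, 0)`, the amount `d² σ² / 4` is moved from the second summand to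
the first one; the two cofactors then have positive coefficients with respect to
`(1 - x) (1 - y)`, `x y` and `x (1 - y) + y (1 - x)`.

The set of nonnegative elements is given by a predicate, for use with commuting operators. -/
theorem hardyPoly_nonneg_of_cone {S : Type*} [CommRing S] {Pos : S → Prop}
    (hadd : ∀ a b, Pos a → Pos b → Pos (a + b)) (hmul : ∀ a b, Pos a → Pos b → Pos (a * b))
    (hsq : ∀ a, Pos (a ^ 2)) (c : ℝ →+* S) (hc : ∀ r, 0 ≤ r → Pos (c r))
    {p : ℝ} (hp : 2 * p ^ 3 - 2 * p ^ 2 + 2 * p = 1) {x y : S}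
    (hx : Pos x) (hx' : Pos (1 - x)) (hy : Pos y) (hy' : Pos (1 - y)) :
    Pos (4000 * hardyPoly (c p) x y - ((x - y) ^ 2 + (x + y - 2 * c p) ^ 2)) := by
  obtain ⟨hl, hu⟩ := cubic_bounds hp
  have hA := hmul _ _ hx' hy'
  have hB := hmul _ _ hx hy
  have he := hadd _ _ (hmul _ _ hx hy') (hmul _ _ hy hx')
  have hxx := hmul _ _ hx hx'
  have hyy := hmul _ _ hy hy'
  have h1 := hc (1000 * ((1 - p) ^ 2 + 2 * (1 - p) * (2 * p - 1)) + 500 * (2 * p - 1)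
    + 250 * (2 * p - 1) ^ 2 - 1) (by nlinarith)
  have h2 := hc (1000 * (p ^ 2 + 2 * (1 - p) * (2 * p - 1)) - 500 * (2 * p - 1)
    + 250 * (2 * p - 1) ^ 2 - 1) (by nlinarith)
  have h3 := hc (250 * (2 * p - 1) ^ 2 - 1000 * ((1 - p) * (2 - 3 * p)) - 1) (by nlinarith)
  have h4 := hc (4000 * (p * (1 - p)) - 251 - 1000 * ((1 - p) ^ 2 + 2 * (1 - p) * (2 * p - 1)))
    (by nlinarith)
  have h5 := hc (4000 * (p * (1 - p)) - 251 - 1000 * (p ^ 2 + 2 * (1 - p) * (2 * p - 1)))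
    (by nlinarith)
  have h6 := hc (4000 * (p * (1 - p)) - 251 + 1000 * ((1 - p) * (2 - 3 * p))) (by nlinarith)
  have h250 := hc 250 (by norm_num)
  have hcub := congrArg c hp
  simp only [map_add, map_sub, map_mul, map_pow, map_one, map_ofNat] at h1 h2 h3 h4 h5 h6 h250 hcub
  have t1 := hmul _ _ (hsq (x - y)) <| hadd _ _ (hadd _ _ (hadd _ _ (hmul _ _ h1 hA)
    (hmul _ _ h2 hB)) (hmul _ _ h3 he))
    (hmul _ _ h250 (hsq (x * y - (1 - x) * (1 - y))))
  have t2 := hmul _ _ (hsq (x + y - 2 * c p)) <| hadd _ _ (hadd _ _ (hmul _ _ h4 hA)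
    (hmul _ _ h5 hB)) (hmul _ _ h6 he)
  have t3 := hmul _ _ h250 <| hmul _ _ (hsq (x + y - 2 * c p)) <|
    hadd _ _ (hadd _ _ hA hB) (hadd _ _ hxx hyy)
  have key := hadd _ _ (hadd _ _ t1 t2) t3
  convert key using 1
  unfold hardyPoly
  linear_combination (-4000 * (1 - c p)) * hcub

/-! ### The inequality for commuting operators -/

section Commuting

variable {H : Type*} [NormedAddCommGroup H] [InnerProductSpace ℂ H] [CompleteSpace H]

theorem hardyPoly_nonneg_of_commute {X Y : H →L[ℂ] H} (hXY : Commute X Y)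
    (hX : 0 ≤ X) (hX' : X ≤ 1) (hY : 0 ≤ Y) (hY' : Y ≤ 1)
    {p : ℝ} (hp : 2 * p ^ 3 - 2 * p ^ 2 + 2 * p = 1) :
    (X - Y) ^ 2 + (X + Y - 2 * algebraMap ℝ (H →L[ℂ] H) p) ^ 2 ≤
      4000 * hardyPoly (algebraMap ℝ (H →L[ℂ] H) p) X Y := by
  have hcomm : ∀ a ∈ ({X, Y} : Set (H →L[ℂ] H)), ∀ b ∈ ({X, Y} : Set (H →L[ℂ] H)),
      a * b = b * a := by
    rintro a (rfl | rfl) b (rfl | rfl)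
    exacts [rfl, hXY, hXY.symm, rfl]
  have hmul := Algebra.isMulCommutative_adjoin ℝ hcomm
  let _ : CommRing (Algebra.adjoin ℝ ({X, Y} : Set (H →L[ℂ] H))) :=
    { (inferInstance : Ring (Algebra.adjoin ℝ ({X, Y} : Set (H →L[ℂ] H)))) with
      mul_comm := hmul.is_comm.comm }
  have hsa : ∀ a ∈ Algebra.adjoin ℝ ({X, Y} : Set (H →L[ℂ] H)), IsSelfAdjoint a := by
    intro a ha
    induction ha using Algebra.adjoin_induction with
    | mem a ha =>
      rcases ha with rfl | rfl
      exacts [.of_nonneg hX, .of_nonneg hY]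
    | algebraMap r => exact .algebraMap _ (.all r)
    | add a b _ _ ha hb => exact ha.add hb
    | mul a b hma hmb ha hb =>
      refine (ha.commute_iff hb).1 ?_
      exact congrArg Subtype.val (mul_comm (⟨a, hma⟩ : Algebra.adjoin ℝ {X, Y}) ⟨b, hmb⟩)
  have key := hardyPoly_nonneg_of_cone (S := Algebra.adjoin ℝ ({X, Y} : Set (H →L[ℂ] H)))
    (Pos := fun s => 0 ≤ (s : H →L[ℂ] H)) (fun a b ha hb => add_nonneg ha hb)
    (fun a b ha hb => opNonneg_mul_of_commute ha hb (congrArg Subtype.val (mul_comm a b)))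
    (fun a => ?_) (algebraMap ℝ _) (fun r hr => ?_) hp
    (x := ⟨X, Algebra.subset_adjoin (by simp)⟩) (y := ⟨Y, Algebra.subset_adjoin (by simp)⟩)
    hX (sub_nonneg.2 hX') hY (sub_nonneg.2 hY')
  · rw [← sub_nonneg]
    exact key
  · have := star_mul_self_nonneg (a : H →L[ℂ] H)
    rwa [(hsa a a.2).star_eq, ← sq] at this
  · exact algebraMap_nonneg _ hr

end Commuting

/-! ### Expectations and compressions of effects -/

section Expectation

variable {H : Type*} [NormedAddCommGroup H] [InnerProductSpace ℂ H]

/-- The real part of the expectation `⟨v, T v⟩`, as a real linear functional of `T`. -/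
noncomputable def expectation (v : H) : (H →L[ℂ] H) →ₗ[ℝ] ℝ where
  toFun T := (⟪v, T v⟫_ℂ).re
  map_add' S T := by simp
  map_smul' r T := by
    rw [smul_apply, inner_smul_right_eq_smul]
    simp

theorem expectation_apply (v : H) (T : H →L[ℂ] H) : expectation v T = (⟪v, T v⟫_ℂ).re := rfl

theorem expectation_one (v : H) : expectation v 1 = ‖v‖ ^ 2 := by
  rw [expectation_apply, one_apply_eq_self, ← inner_self_eq_norm_sq (𝕜 := ℂ)]
  rfl

theorem expectation_nonneg (v : H) {T : H →L[ℂ] H} (hT : 0 ≤ T) : 0 ≤ expectation v T :=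
  re_inner_nonneg_of_opNonneg hT v

theorem expectation_hardyPoly (v : H) (p : ℝ) (X Y : H →L[ℂ] H) :
    expectation v (hardyPoly (algebraMap ℝ (H →L[ℂ] H) p) X Y) =
      (1 - p) ^ 4 * ‖v‖ ^ 2 + p * (1 - p) * (‖v‖ ^ 2 - expectation v X - expectation v Y) +
      2 * (1 - p) ^ 2 * expectation v (X * Y) -
      expectation v (X * Y * ((1 - X) * (1 - Y))) := by
  have h : hardyPoly (algebraMap ℝ (H →L[ℂ] H) p) X Y =
      ((1 - p) ^ 4) • (1 : H →L[ℂ] H) + (p * (1 - p)) • (1 - X - Y + X * Y) +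
      (2 * (1 - p) ^ 2 - p * (1 - p)) • (X * Y) - X * Y * ((1 - X) * (1 - Y)) := by
    have h2 : (2 : H →L[ℂ] H) = algebraMap ℝ (H →L[ℂ] H) 2 :=
      (map_ofNat (algebraMap ℝ (H →L[ℂ] H)) 2).symm
    unfold hardyPoly
    simp only [Algebra.smul_def, map_sub, map_mul, map_pow, map_one]
    rw [← h2]
    noncomm_ring
  rw [h]
  simp only [map_add, map_sub, map_smul, expectation_one, smul_eq_mul]
  ring

variable [CompleteSpace H]

theorem expectation_star_mul_self (v : H) (S : H →L[ℂ] H) :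
    expectation v (star S * S) = ‖S v‖ ^ 2 := by
  rw [expectation_apply, mul_apply_eq_comp, ContinuousLinearMap.star_eq_adjoint,
    ContinuousLinearMap.adjoint_inner_right, ← inner_self_eq_norm_sq (𝕜 := ℂ)]
  rfl

theorem expectation_sq (v : H) {S : H →L[ℂ] H} (hS : IsSelfAdjoint S) :
    expectation v (S ^ 2) = ‖S v‖ ^ 2 := by
  rw [← expectation_star_mul_self, hS.star_eq, sq]

theorem expectation_mono (v : H) {S T : H →L[ℂ] H} (h : S ≤ T) :
    expectation v S ≤ expectation v T := by
  rw [← sub_nonneg, ← map_sub]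
  exact expectation_nonneg v (sub_nonneg.2 h)

theorem expectation_mul_of_selfAdjoint {v w : H} {S T : H →L[ℂ] H} (hS : IsSelfAdjoint S)
    (hv : S v = w) : expectation v (S * T) = (⟪w, T v⟫_ℂ).re := by
  rw [expectation_apply, mul_apply_eq_comp, ← ContinuousLinearMap.adjoint_inner_left,
    ← ContinuousLinearMap.star_eq_adjoint, hS.star_eq, hv]

/-- For effects `E`, `Q`, the compression `X = (1 - E) Q (1 - E)` is an effect, and its defect
`X - X²` splits into three positive parts: `u* u` for the off-diagonal part `u = E Q (1 - E)`, the
compression of `Q - Q²`, and a remainder which is zero if `E` is a projection. -/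
theorem compression_bounds {E Q : H →L[ℂ] H} (hE : 0 ≤ E) (hE' : E ≤ 1) (hQ : 0 ≤ Q)
    (hQ' : Q ≤ 1) :
    0 ≤ (1 - E) * Q * (1 - E) ∧ (1 - E) * Q * (1 - E) ≤ 1 ∧
    0 ≤ (1 - E) * (Q - Q ^ 2) * (1 - E) ∧
    star (E * Q * (1 - E)) * (E * Q * (1 - E)) + (1 - E) * (Q - Q ^ 2) * (1 - E) ≤
      (1 - E) * Q * (1 - E) - ((1 - E) * Q * (1 - E)) ^ 2 := by
  have sE : star E = E := (IsSelfAdjoint.of_nonneg hE).star_eq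
  have sQ : star Q = Q := (IsSelfAdjoint.of_nonneg hQ).star_eq
  have sF : star (1 - E) = 1 - E := by rw [star_sub, star_one, sE]
  have conj {T : H →L[ℂ] H} (hT : 0 ≤ T) : 0 ≤ (1 - E) * T * (1 - E) := by
    have := star_left_conjugate_nonneg hT (1 - E)
    rwa [sF] at this
  have hF : 0 ≤ 1 - E := sub_nonneg.2 hE'
  have hEF : 0 ≤ E - E ^ 2 := by
    have := opNonneg_mul_of_commute hE hF ((Commute.one_right E).sub_right (Commute.refl E))
    rwa [mul_sub, mul_one, ← sq] at this
  have hQQ : 0 ≤ Q - Q ^ 2 := by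
    have := opNonneg_mul_of_commute hQ (sub_nonneg.2 hQ')
      ((Commute.one_right Q).sub_right (Commute.refl Q))
    rwa [mul_sub, mul_one, ← sq] at this
  refine ⟨conj hQ, ?_, conj hQQ, ?_⟩
  · -- `1 - F Q F = F (1 - Q) F + (1 - F ^ 2)` with `F = 1 - E`
    have h := add_nonneg (add_nonneg (conj (sub_nonneg.2 hQ')) hE) hEF
    rw [← sub_nonneg]
    convert h using 1
    noncomm_ring
  · have h : 0 ≤ star Q * (E - E ^ 2) * Q := star_left_conjugate_nonneg hEF Q
    rw [sQ] at h
    have h2 := conj (add_nonneg h h)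
    rw [← sub_nonneg, star_mul, star_mul, sE, sQ, sF]
    convert h2 using 1
    noncomm_ring

end Expectation

/-! ### Commuting effects with Hardy-type zeros -/

section HardyConfig

variable {H : Type*} [NormedAddCommGroup H] [InnerProductSpace ℂ H]

theorem Commute.clm_apply_comm {S T : H →L[ℂ] H} (h : Commute S T) (v : H) : S (T v) = T (S v) :=
  congrArg (fun L : H →L[ℂ] H => L v) h.eq

/-- Effects `E`, `Q` of one party and `E'`, `R` of the other one, acting on a common Hilbert space,
and a (not necessarily normalized) vector `ψ` with
`E (1 - E') ψ = (1 - E) E' ψ = Q R ψ = 0`. -/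
structure HardyConfig (E Q E' R : H →L[ℂ] H) (ψ : H) : Prop where
  E_nonneg : 0 ≤ E
  E_le_one : E ≤ 1
  Q_nonneg : 0 ≤ Q
  Q_le_one : Q ≤ 1
  E'_nonneg : 0 ≤ E'
  E'_le_one : E' ≤ 1
  R_nonneg : 0 ≤ R
  R_le_one : R ≤ 1
  comm_E_E' : Commute E E'
  comm_E_R : Commute E R
  comm_Q_E' : Commute Q E'
  comm_Q_R : Commute Q R
  E_apply_sub : E (ψ - E' ψ) = 0
  E'_apply_sub : E' (ψ - E ψ) = 0
  Q_R_apply : Q (R ψ) = 0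

namespace HardyConfig

variable {E Q E' R : H →L[ℂ] H} {ψ : H} (h : HardyConfig E Q E' R ψ)

include h

theorem symm : HardyConfig E' R E Q ψ where
  E_nonneg := h.E'_nonneg
  E_le_one := h.E'_le_one
  Q_nonneg := h.R_nonneg
  Q_le_one := h.R_le_one
  E'_nonneg := h.E_nonneg
  E'_le_one := h.E_le_one
  R_nonneg := h.Q_nonneg
  R_le_one := h.Q_le_one
  comm_E_E' := h.comm_E_E'.symm
  comm_E_R := h.comm_Q_E'.symm
  comm_Q_E' := h.comm_E_R.symm
  comm_Q_R := h.comm_Q_R.symm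
  E_apply_sub := h.E'_apply_sub
  E'_apply_sub := h.E_apply_sub
  Q_R_apply := by rw [← h.comm_Q_R.clm_apply_comm, h.Q_R_apply]

theorem E_apply_eq : E ψ = E' ψ := by
  have h1 := h.E_apply_sub
  have h2 := h.E'_apply_sub
  rw [map_sub, sub_eq_zero] at h1 h2
  rw [h1, h.comm_E_E'.clm_apply_comm, ← h2]

theorem E_apply_E : E (E ψ) = E ψ := by
  have h1 := h.E_apply_sub
  rw [← h.E_apply_eq, map_sub, sub_eq_zero] at h1
  exact h1.symm

theorem E'_apply_E : E' (E ψ) = E ψ := by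
  rw [h.E_apply_eq, h.symm.E_apply_E]

theorem E_apply_compl : E (ψ - E ψ) = 0 := by rw [map_sub, h.E_apply_E, sub_self]

theorem offDiag_apply :
    (E * Q * (1 - E)) ((E' * R * (1 - E')) (ψ - E ψ)) = E (E' (Q (R (ψ - E ψ)))) := by
  set w := ψ - E ψ with hw
  have h1 : E' w = 0 := h.E'_apply_sub
  have h2 : E (R w) = 0 := by rw [h.comm_E_R.clm_apply_comm, h.E_apply_compl, map_zero]
  simp only [mul_apply_eq_comp, sub_apply, one_apply_eq_self, h1, sub_zero]
  rw [h.comm_E_E'.clm_apply_comm (R _), h2, map_zero, sub_zero, h.comm_Q_E'.clm_apply_comm]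

theorem mem_centralizer :
    E ∈ Subring.centralizer {E', R} ∧ Q ∈ Subring.centralizer {E', R} ∧
    E' ∈ Subring.centralizer (Subring.centralizer {E', R} : Set (H →L[ℂ] H)) ∧
    R ∈ Subring.centralizer (Subring.centralizer {E', R} : Set (H →L[ℂ] H)) := by
  refine ⟨?_, ?_, fun a ha => (ha E' (by simp)).symm, fun a ha => (ha R (by simp)).symm⟩
  · rintro b (rfl | rfl)
    exacts [h.comm_E_E'.symm.eq, h.comm_E_R.symm.eq]
  · rintro b (rfl | rfl)
    exacts [h.comm_Q_E'.symm.eq, h.comm_Q_R.symm.eq]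

variable [CompleteSpace H]


theorem norm_sq_eq : ‖ψ‖ ^ 2 = ‖E ψ‖ ^ 2 + ‖ψ - E ψ‖ ^ 2 := by
  have : ⟪E ψ, ψ - E ψ⟫_ℂ = 0 := by
    rw [← h.E_apply_E, ← (IsSelfAdjoint.of_nonneg h.E_nonneg).adjoint_eq,
      ContinuousLinearMap.adjoint_inner_left, (IsSelfAdjoint.of_nonneg h.E_nonneg).adjoint_eq,
      h.E_apply_E, h.E_apply_compl, inner_zero_right]
  have := norm_add_sq_eq_norm_sq_add_norm_sq_of_inner_eq_zero _ _ this
  rw [add_sub_cancel] at this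
  simpa only [sq] using this

theorem star_offDiag : star (E * Q * (1 - E)) = (1 - E) * Q * E := by
  rw [star_mul, star_mul, star_sub, star_one, (IsSelfAdjoint.of_nonneg h.E_nonneg).star_eq,
    (IsSelfAdjoint.of_nonneg h.Q_nonneg).star_eq, mul_assoc]

theorem commute_blocks :
    Commute ((1 - E) * Q * (1 - E)) ((1 - E') * R * (1 - E')) ∧
    Commute (E * Q * (1 - E)) (E' * R * (1 - E')) ∧
    Commute (E * Q * (1 - E)) (star (E' * R * (1 - E'))) := by
  obtain ⟨hE, hQ, hE', hR⟩ := h.mem_centralizer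
  rw [h.symm.star_offDiag]
  have hF := sub_mem (one_mem _) hE
  have hF' := sub_mem (one_mem _) hE'
  have hu := mul_mem (mul_mem hE hQ) hF
  exact ⟨(mul_mem (mul_mem hF' hR) hF' _ (mul_mem (mul_mem hF hQ) hF)),
    (mul_mem (mul_mem hE' hR) hF' _ hu), (mul_mem (mul_mem hF' hR) hE' _ hu)⟩

theorem expectation_Q :
    expectation (ψ - E ψ) ((1 - E) * Q * (1 - E)) = expectation (ψ - E ψ) Q := by
  have hF : IsSelfAdjoint (1 - E) := .sub (.one _) (.of_nonneg h.E_nonneg)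
  have hv : (1 - E) (ψ - E ψ) = ψ - E ψ := by
    rw [sub_apply, one_apply_eq_self, h.E_apply_compl, sub_zero]
  rw [mul_assoc, expectation_mul_of_selfAdjoint hF hv, mul_apply_eq_comp, hv, expectation_apply]

theorem expectation_Q_R :
    expectation (ψ - E ψ) (((1 - E) * Q * (1 - E)) * ((1 - E') * R * (1 - E'))) =
      (⟪ψ - E ψ, Q (R (ψ - E ψ))⟫_ℂ).re := by
  set w := ψ - E ψ with hw
  have hF : IsSelfAdjoint (1 - E) := .sub (.one _) (.of_nonneg h.E_nonneg)
  have hF' : IsSelfAdjoint (1 - E') := .sub (.one _) (.of_nonneg h.E'_nonneg)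
  have h0 : E w = 0 := h.E_apply_compl
  have h0' : E' w = 0 := h.E'_apply_sub
  have hv : (1 - E) w = w := by rw [sub_apply, one_apply_eq_self, h0, sub_zero]
  have hv' : (1 - E') w = w := by rw [sub_apply, one_apply_eq_self, h0', sub_zero]
  have hFE' : Commute (1 - E) (1 - E') :=
    ((Commute.one_left _).sub_left ((Commute.one_right E).sub_right h.comm_E_E'))
  have hFR : Commute (1 - E) R := (Commute.one_left _).sub_left h.comm_E_R
  have hQF' : Commute Q (1 - E') := (Commute.one_right _).sub_right h.comm_Q_E'
  have e : ((1 - E) * Q * (1 - E)) * ((1 - E') * R * (1 - E')) =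
      (1 - E) * ((1 - E') * (Q * (R * ((1 - E) * (1 - E'))))) := by
    calc _ = (1 - E) * (Q * (((1 - E) * (1 - E')) * R * (1 - E'))) := by noncomm_ring
      _ = (1 - E) * ((Q * (1 - E')) * ((1 - E) * R) * (1 - E')) := by
        rw [hFE'.eq]; simp only [mul_assoc]
      _ = _ := by rw [hQF'.eq, hFR.eq]; simp only [mul_assoc]
  rw [e, expectation_mul_of_selfAdjoint hF hv, ← expectation_apply,
    expectation_mul_of_selfAdjoint hF' hv']
  simp only [mul_apply_eq_comp, hv', hv]

theorem inner_E_offDiag :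
    (⟪E ψ, E (E' (Q (R (ψ - E ψ))))⟫_ℂ).re = - (⟪ψ - E ψ, Q (R (ψ - E ψ))⟫_ℂ).re := by
  have sE := (IsSelfAdjoint.of_nonneg h.E_nonneg).adjoint_eq
  have sE' := (IsSelfAdjoint.of_nonneg h.E'_nonneg).adjoint_eq
  have sQ := (IsSelfAdjoint.of_nonneg h.Q_nonneg).adjoint_eq
  have sR := (IsSelfAdjoint.of_nonneg h.R_nonneg).adjoint_eq
  rw [← ContinuousLinearMap.adjoint_inner_left E, sE, h.E_apply_E,
    ← ContinuousLinearMap.adjoint_inner_left E', sE', h.E'_apply_E,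
    ← ContinuousLinearMap.adjoint_inner_left Q, sQ, ← ContinuousLinearMap.adjoint_inner_left R, sR,
    ← h.comm_Q_R.clm_apply_comm]
  have h0 : Q (R (E ψ)) = - Q (R (ψ - E ψ)) := by
    rw [map_sub, map_sub, h.Q_R_apply]; simp
  rw [h0, inner_neg_left, Complex.neg_re, ← Complex.conj_re, inner_conj_symm]

end HardyConfig

end HardyConfig

/-! ### The Hardy functional and its extremal vectors -/

section HardyBound

variable {H : Type*} [NormedAddCommGroup H] [InnerProductSpace ℂ H] [CompleteSpace H]

namespace HardyConfig

variable {E Q E' R : H →L[ℂ] H} {ψ : H} (h : HardyConfig E Q E' R ψ)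

include h

/-- With `X = (1 - E) Q (1 - E)`, `Y = (1 - E') R (1 - E')` and the off-diagonal parts `u`, `v` of
`Q` and `R`, the deficit of the Hardy functional is a sum of three terms, each of which turns out to
be nonnegative. -/
theorem deficit_eq (p : ℝ) :
    (1 - p) ^ 4 * ‖ψ‖ ^ 2 - p * (1 - p) * (expectation (ψ - E ψ) Q + expectation (ψ - E ψ) R -
        ‖ψ - E ψ‖ ^ 2) =
      ‖(((1 - p) ^ 2 : ℝ) : ℂ) • E ψ + E (E' (Q (R (ψ - E ψ))))‖ ^ 2 +
      expectation (ψ - E ψ)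
        (((1 - E) * Q * (1 - E) - ((1 - E) * Q * (1 - E)) ^ 2) *
            ((1 - E') * R * (1 - E') - ((1 - E') * R * (1 - E')) ^ 2) -
          (star (E * Q * (1 - E)) * (E * Q * (1 - E))) *
            (star (E' * R * (1 - E')) * (E' * R * (1 - E')))) +
      expectation (ψ - E ψ) (hardyPoly (algebraMap ℝ (H →L[ℂ] H) p)
        ((1 - E) * Q * (1 - E)) ((1 - E') * R * (1 - E'))) := by
  obtain ⟨cXY, cuv, cuv'⟩ := h.commute_blocks
  have eX := h.expectation_Q
  have eY := h.symm.expectation_Q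
  rw [← h.E_apply_eq] at eY
  have eXY := h.expectation_Q_R
  have eI := h.inner_E_offDiag
  have eN := h.norm_sq_eq
  have eφ := h.offDiag_apply
  set w := ψ - E ψ
  set X := (1 - E) * Q * (1 - E)
  set Y := (1 - E') * R * (1 - E')
  set u := E * Q * (1 - E)
  set v := E' * R * (1 - E')
  have e1 : (X - X ^ 2) * (Y - Y ^ 2) = X * Y * ((1 - X) * (1 - Y)) := by
    have : Y * (1 - X) = (1 - X) * Y := by rw [mul_sub, sub_mul, cXY.eq, one_mul, mul_one]
    calc _ = X * ((1 - X) * Y) * (1 - Y) := by noncomm_ring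
      _ = _ := by rw [← this]; noncomm_ring
  have e2 : (star u * u) * (star v * v) = star (u * v) * (u * v) := by
    calc _ = star u * (u * star v) * v := by noncomm_ring
      _ = star u * (star v * u) * v := by rw [cuv'.eq]
      _ = (star u * star v) * (u * v) := by noncomm_ring
      _ = _ := by rw [← star_mul, ← cuv.eq]
  have e3 : ‖(((1 - p) ^ 2 : ℝ) : ℂ) • E ψ + E (E' (Q (R w)))‖ ^ 2 =
      (1 - p) ^ 4 * ‖E ψ‖ ^ 2 + 2 * (1 - p) ^ 2 * (⟪E ψ, E (E' (Q (R w)))⟫_ℂ).re +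
        ‖E (E' (Q (R w)))‖ ^ 2 := by
    rw [norm_add_sq (𝕜 := ℂ), norm_smul, inner_smul_left, Complex.conj_ofReal, Complex.norm_real,
      mul_pow, Real.norm_eq_abs, sq_abs]
    simp only [RCLike.re_eq_complex_re, Complex.re_ofReal_mul]
    ring
  rw [e1, map_sub (expectation w), e2, expectation_star_mul_self, mul_apply_eq_comp, eφ,
    expectation_hardyPoly, e3, eI, eN, eX, eY, eXY]
  ring

/-- The second summand of `deficit_eq` dominates the contribution of the non-projective part of
`Q`. -/
theorem expectation_offDiag_bounds :
    0 ≤ expectation (ψ - E ψ) (((1 - E) * (Q - Q ^ 2) * (1 - E)) *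
        ((1 - E') * R * (1 - E') - ((1 - E') * R * (1 - E')) ^ 2)) ∧
    expectation (ψ - E ψ) (((1 - E) * (Q - Q ^ 2) * (1 - E)) *
        ((1 - E') * R * (1 - E') - ((1 - E') * R * (1 - E')) ^ 2)) ≤
      expectation (ψ - E ψ)
        (((1 - E) * Q * (1 - E) - ((1 - E) * Q * (1 - E)) ^ 2) *
            ((1 - E') * R * (1 - E') - ((1 - E') * R * (1 - E')) ^ 2) -
          (star (E * Q * (1 - E)) * (E * Q * (1 - E))) *
            (star (E' * R * (1 - E')) * (E' * R * (1 - E')))) := by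
  obtain ⟨-, -, hδ, hα⟩ := compression_bounds h.E_nonneg h.E_le_one h.Q_nonneg h.Q_le_one
  obtain ⟨-, -, hδ', hβ⟩ := compression_bounds h.E'_nonneg h.E'_le_one h.R_nonneg h.R_le_one
  obtain ⟨hE, hQ, hE', hR⟩ := h.mem_centralizer
  have hF := sub_mem (one_mem _) hE
  have hF' := sub_mem (one_mem _) hE'
  have mX := mul_mem (mul_mem hF hQ) hF
  have mY := mul_mem (mul_mem hF' hR) hF'
  have mα := mul_mem (mul_mem (mul_mem hF hQ) hE) (mul_mem (mul_mem hE hQ) hF)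
  have mβ := mul_mem (mul_mem (mul_mem hF' hR) hE') (mul_mem (mul_mem hE' hR) hF')
  rw [← h.star_offDiag] at mα
  rw [← h.symm.star_offDiag] at mβ
  have mδ := mul_mem (mul_mem hF (sub_mem hQ (pow_mem hQ 2))) hF
  have pα := star_mul_self_nonneg (E * Q * (1 - E))
  have pβ := star_mul_self_nonneg (E' * R * (1 - E'))
  set α := star (E * Q * (1 - E)) * (E * Q * (1 - E))
  set β := star (E' * R * (1 - E')) * (E' * R * (1 - E'))
  set δ := (1 - E) * (Q - Q ^ 2) * (1 - E)
  set δ' := (1 - E') * (R - R ^ 2) * (1 - E')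
  set X := (1 - E) * Q * (1 - E)
  set Y := (1 - E') * R * (1 - E')
  have mA := sub_mem mX (pow_mem mX 2)
  have mB := sub_mem mY (pow_mem mY 2)
  have hβ' : 0 ≤ Y - Y ^ 2 - β := sub_nonneg.2 ((le_add_of_nonneg_right hδ').trans hβ)
  have hB : 0 ≤ Y - Y ^ 2 := (add_nonneg pβ hδ').trans hβ
  have h1 := opNonneg_mul_of_commute hδ hB (mB _ mδ)
  have h2 := opNonneg_mul_of_commute (sub_nonneg.2 hα) hB (mB _ (sub_mem mA (add_mem mα mδ)))
  have h3 := opNonneg_mul_of_commute pα hβ' (sub_mem mB mβ _ mα)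
  refine ⟨expectation_nonneg _ h1, expectation_mono _ ?_⟩
  rw [← sub_nonneg]
  convert add_nonneg h2 h3 using 1
  noncomm_ring

/-- The last summand of `deficit_eq` controls the distance of `X ψ₁` and `Y ψ₁` from `p ψ₁`, where
`ψ₁ = (1 - E) ψ`. The constant `4000` is not sharp; that the summand vanishes only for
`X ψ₁ = Y ψ₁ = p ψ₁` is what matters. -/
theorem le_expectation_hardyPoly {p : ℝ} (hp : 2 * p ^ 3 - 2 * p ^ 2 + 2 * p = 1) :
    ‖((1 - E) * Q * (1 - E)) (ψ - E ψ) - ((1 - E') * R * (1 - E')) (ψ - E ψ)‖ ^ 2 +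
      ‖((1 - E) * Q * (1 - E)) (ψ - E ψ) + ((1 - E') * R * (1 - E')) (ψ - E ψ) -
        ((2 * p : ℝ) : ℂ) • (ψ - E ψ)‖ ^ 2 ≤
    4000 * expectation (ψ - E ψ) (hardyPoly (algebraMap ℝ (H →L[ℂ] H) p)
        ((1 - E) * Q * (1 - E)) ((1 - E') * R * (1 - E'))) := by
  obtain ⟨hX, hX1, -, -⟩ := compression_bounds h.E_nonneg h.E_le_one h.Q_nonneg h.Q_le_one
  obtain ⟨hY, hY1, -, -⟩ := compression_bounds h.E'_nonneg h.E'_le_one h.R_nonneg h.R_le_one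
  have key := hardyPoly_nonneg_of_commute h.commute_blocks.1 hX hX1 hY hY1 hp
  set w := ψ - E ψ
  set X := (1 - E) * Q * (1 - E)
  set Y := (1 - E') * R * (1 - E')
  have e2 : 2 * algebraMap ℝ (H →L[ℂ] H) p = algebraMap ℝ (H →L[ℂ] H) (2 * p) := by
    rw [map_mul, map_ofNat]
  have sX : IsSelfAdjoint X := .of_nonneg hX
  have sY : IsSelfAdjoint Y := .of_nonneg hY
  have s3 : IsSelfAdjoint (X + Y - algebraMap ℝ (H →L[ℂ] H) (2 * p)) :=
    (sX.add sY).sub (.algebraMap _ (.all _))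
  have e4 : (4000 : H →L[ℂ] H) = algebraMap ℝ (H →L[ℂ] H) 4000 :=
    (map_ofNat (algebraMap ℝ (H →L[ℂ] H)) 4000).symm
  have := expectation_mono w key
  rw [e2, e4, ← Algebra.smul_def, map_smul, map_add, expectation_sq _ (sX.sub sY),
    expectation_sq _ s3, smul_eq_mul] at this
  convert this using 4
  · rfl
  rw [sub_apply, add_apply, Algebra.algebraMap_eq_smul_one, smul_apply, one_apply_eq_self]
  rfl

/-- The Hardy functional is bounded, since every summand of `deficit_eq` is nonnegative. -/
theorem hardy_bound {p : ℝ} (hp : 2 * p ^ 3 - 2 * p ^ 2 + 2 * p = 1) :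
    p * (1 - p) * (expectation (ψ - E ψ) Q + expectation (ψ - E ψ) R - ‖ψ - E ψ‖ ^ 2) ≤
      (1 - p) ^ 4 * ‖ψ‖ ^ 2 := by
  have h1 := h.le_expectation_hardyPoly hp
  have h2 := h.expectation_offDiag_bounds
  have h3 := h.deficit_eq p
  have h4 := h2.1.trans h2.2
  nlinarith [sq_nonneg ‖(((1 - p) ^ 2 : ℝ) : ℂ) • E ψ + E (E' (Q (R (ψ - E ψ))))‖,
    sq_nonneg ‖((1 - E) * Q * (1 - E)) (ψ - E ψ) - ((1 - E') * R * (1 - E')) (ψ - E ψ)‖,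
    sq_nonneg ‖((1 - E) * Q * (1 - E)) (ψ - E ψ) + ((1 - E') * R * (1 - E')) (ψ - E ψ) -
        ((2 * p : ℝ) : ℂ) • (ψ - E ψ)‖]

/-- Rigidity: if the bound is attained, then on the component `ψ₁ = (1 - E) ψ` the effect `Q` acts
as a projection whose compression is the scalar `p`, and `ψ₁` determines `E ψ`. -/
theorem rigidity {p : ℝ} (hp : 2 * p ^ 3 - 2 * p ^ 2 + 2 * p = 1)
    (hmax : p * (1 - p) * (expectation (ψ - E ψ) Q + expectation (ψ - E ψ) R - ‖ψ - E ψ‖ ^ 2) =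
      (1 - p) ^ 4 * ‖ψ‖ ^ 2) :
    (((1 - p) ^ 2 : ℝ) : ℂ) • E ψ + E (E' (Q (R (ψ - E ψ)))) = 0 ∧
    Q (ψ - E ψ) - E (Q (ψ - E ψ)) = (p : ℂ) • (ψ - E ψ) ∧
    Q (Q (ψ - E ψ)) = Q (ψ - E ψ) := by
  obtain ⟨hl, hu⟩ := cubic_bounds hp
  have h1 := h.le_expectation_hardyPoly hp
  have h2 := h.expectation_offDiag_bounds
  have h3 := h.deficit_eq p
  have h5 := h.expectation_Q
  have hEw := h.E_apply_compl
  have hQQ : 0 ≤ Q - Q ^ 2 := by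
    have := opNonneg_mul_of_commute h.Q_nonneg (sub_nonneg.2 h.Q_le_one)
      ((Commute.one_right Q).sub_right (Commute.refl Q))
    rwa [mul_sub, mul_one, ← sq] at this
  have hF : IsSelfAdjoint (1 - E) := .sub (.one _) (.of_nonneg h.E_nonneg)
  set w := ψ - E ψ
  have hv : (1 - E) w = w := by rw [sub_apply, one_apply_eq_self, hEw, sub_zero]
  rw [hmax, sub_self] at h3
  have n1 := sq_nonneg ‖(((1 - p) ^ 2 : ℝ) : ℂ) • E ψ + E (E' (Q (R w)))‖
  have n2 := sq_nonneg ‖((1 - E) * Q * (1 - E)) w - ((1 - E') * R * (1 - E')) w‖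
  have n3 := sq_nonneg ‖((1 - E) * Q * (1 - E)) w + ((1 - E') * R * (1 - E')) w -
        ((2 * p : ℝ) : ℂ) • w‖
  have z1 : ‖(((1 - p) ^ 2 : ℝ) : ℂ) • E ψ + E (E' (Q (R w)))‖ ^ 2 = 0 := by linarith [h2.1, h2.2]
  have z2 : ‖((1 - E) * Q * (1 - E)) w - ((1 - E') * R * (1 - E')) w‖ ^ 2 = 0 := by
    linarith [h2.1, h2.2]
  have z3 : ‖((1 - E) * Q * (1 - E)) w + ((1 - E') * R * (1 - E')) w -
        ((2 * p : ℝ) : ℂ) • w‖ ^ 2 = 0 := by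
    linarith [h2.1, h2.2]
  have z4 := le_antisymm (h2.2.trans (by linarith)) h2.1
  rw [sq_eq_zero_iff, norm_eq_zero] at z1 z2 z3
  rw [sub_eq_zero] at z2
  have hY : ((1 - E') * R * (1 - E')) w = (p : ℂ) • w := by
    rw [z2, sub_eq_zero, ← two_smul ℂ, Complex.ofReal_mul, mul_smul] at z3
    exact smul_right_injective H (by norm_num : (2 : ℂ) ≠ 0) (by simpa using z3)
  have hX := z2.trans hY
  refine ⟨z1, ?_, ?_⟩
  · simpa only [mul_apply_eq_comp, hv, sub_apply, one_apply_eq_self] using hX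
  · -- the defect `Q - Q ^ 2` has vanishing expectation, hence kills `w`
    have e : expectation w (((1 - E) * (Q - Q ^ 2) * (1 - E)) *
        ((1 - E') * R * (1 - E') - ((1 - E') * R * (1 - E')) ^ 2)) =
        (p * (1 - p)) * expectation w (Q - Q ^ 2) := by
      have e1 : ((1 - E') * R * (1 - E') - ((1 - E') * R * (1 - E')) ^ 2 : H →L[ℂ] H) w =
          ((p * (1 - p) : ℝ) : ℂ) • w := by
        rw [sub_apply, sq, mul_apply_eq_comp _ ((1 - E') * R * (1 - E')), hY, map_smul, hY,
          smul_smul, ← sub_smul]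
        push_cast
        ring_nf
      rw [mul_assoc (1 - E), mul_assoc (1 - E), expectation_mul_of_selfAdjoint hF hv,
        mul_apply_eq_comp, mul_apply_eq_comp, e1, map_smul, hv, map_smul, inner_smul_right,
        Complex.re_ofReal_mul, expectation_apply]
    rw [e] at z4
    have hpp : p * (1 - p) ≠ 0 := by nlinarith
    have := apply_eq_zero_of_opNonneg hQQ ((mul_eq_zero.1 z4).resolve_left hpp)
    rw [sub_apply, sq, mul_apply_eq_comp, sub_eq_zero] at this
    exact this.symm

end HardyConfig

end HardyBound

/-! ### The constants -/

namespace Class3b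

theorem tan_theta : Real.tan θ = 1 / 3 * (-1 - 2 / τ + τ) := Real.tan_arctan _

theorem τ_pos : 0 < τ := Real.rpow_pos_of_pos (by positivity) _

theorem τ_pow_three : τ ^ 3 = 17 + 3 * √33 := by
  rw [τ, ← Real.rpow_natCast, ← Real.rpow_mul (by positivity)]
  norm_num

/-- Cardano's formula: `-2 / τ` is the conjugate cube root `∛(17 - 3√33)`. -/
theorem tan_theta_cubic : Real.tan θ ^ 3 + Real.tan θ ^ 2 + Real.tan θ = 1 := by
  have h0 := τ_pos.ne'
  have h3 := τ_pow_three
  have hs : √33 ^ 2 = 33 := Real.sq_sqrt (by norm_num)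
  have h6 : τ ^ 6 = 34 * τ ^ 3 + 8 := by
    rw [show τ ^ 6 = (τ ^ 3) ^ 2 by ring, h3]
    linear_combination 9 * hs
  rw [tan_theta]
  field_simp
  linear_combination h6

theorem tan_theta_pos : 0 < Real.tan θ := by
  nlinarith [tan_theta_cubic, sq_nonneg (Real.tan θ), sq_nonneg (Real.tan θ + 1),
    sq_nonneg (Real.tan θ + 1 / 2)]

/-- `p = cos² α`, the probability `⟨1|M|1⟩` of the effect `M` of Alice's outcome `1` for the
setting `1` in the reference strategy. -/
noncomputable def prob : ℝ := 1 / (1 + Real.tan θ)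

theorem prob_cubic : 2 * prob ^ 3 - 2 * prob ^ 2 + 2 * prob = 1 := by
  have h := tan_theta_cubic
  have h0 := tan_theta_pos
  unfold prob
  field_simp
  linear_combination -h

theorem tan_theta_mul_prob : Real.tan θ * prob = 1 - prob := by
  have h0 := tan_theta_pos
  unfold prob
  field_simp
  ring

theorem cos_theta_pos : 0 < Real.cos θ := Real.cos_arctan_pos _

theorem prob_mul_sin_theta : prob * Real.sin θ = (1 - prob) * Real.cos θ := by
  rw [← tan_theta_mul_prob, ← Real.tan_mul_cos cos_theta_pos.ne']
  ring

theorem sin_sq_theta : Real.sin θ ^ 2 = prob * (1 - prob) := by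
  have h1 := prob_mul_sin_theta
  have h2 := prob_cubic
  have h3 := Real.sin_sq_add_cos_sq θ
  have hp := (cubic_bounds h2).2
  have h4 : prob ^ 2 * Real.sin θ ^ 2 = (1 - prob) ^ 2 * (1 - Real.sin θ ^ 2) := by
    rw [← eq_sub_of_add_eq' h3, ← mul_pow, h1, mul_pow]
  -- `p² + q² = q / p` by the cubic equation
  have h5 : (1 - prob) * (Real.sin θ ^ 2 - prob * (1 - prob)) = 0 := by
    linear_combination prob * h4 - Real.sin θ ^ 2 * h2
  exact sub_eq_zero.1 ((mul_eq_zero.1 h5).resolve_left (by linarith))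

theorem sin_theta_pos : 0 < Real.sin θ := by
  rw [← Real.tan_mul_cos cos_theta_pos.ne']
  exact mul_pos tan_theta_pos cos_theta_pos

theorem cos_sq_theta : Real.cos θ ^ 2 = 1 - prob * (1 - prob) := by
  rw [← sin_sq_theta, Real.cos_sq']

theorem cos_sq_alpha : Real.cos α ^ 2 = prob := by
  rw [α, Real.cos_sq_arctan, Real.sq_sqrt tan_theta_pos.le, prob]

theorem cos_two_alpha : Real.cos (2 * α) = 2 * prob - 1 := by
  rw [Real.cos_two_mul, cos_sq_alpha]

theorem sin_two_alpha : Real.sin (2 * α) = 2 * √(prob * (1 - prob)) := by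
  have hc : 0 ≤ Real.cos α := (Real.cos_arctan_pos _).le
  have hs : 0 ≤ Real.sin α := by
    rw [α, Real.sin_arctan]
    positivity
  rw [Real.sin_two_mul, Real.sqrt_mul (by rw [← cos_sq_alpha]; positivity), ← cos_sq_alpha,
    ← Real.sin_sq, Real.sqrt_sq hc, Real.sqrt_sq hs]
  ring

theorem cos_two_beta : Real.cos (2 * β) = 1 - 2 * prob := by
  rw [β, mul_sub, mul_div_cancel₀ _ two_ne_zero, Real.cos_pi_sub, cos_two_alpha, neg_sub]

theorem sin_two_beta : Real.sin (2 * β) = 2 * √(prob * (1 - prob)) := by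
  rw [β, mul_sub, mul_div_cancel₀ _ two_ne_zero, Real.sin_pi_sub, sin_two_alpha]

theorem κ₂_eq : κ₂ = (1 - prob) * (1 - prob * (1 - prob)) := by
  have h : Real.cos (2 * Real.arctan √(Real.tan θ)) = 2 * prob - 1 := cos_two_alpha
  rw [κ₂, h, ← cos_sq_theta]
  have := cos_theta_pos.ne'
  field_simp
  ring

theorem κ₁_eq : κ₁ = 1 / 2 - (1 - prob) - prob * (1 - prob) * (2 * prob - 1) := by
  have h0 := τ_pos.ne'
  have h1 : (τ ^ 2 - τ - 2) / (3 * τ) = Real.tan θ := by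
    rw [tan_theta]
    field_simp
    ring
  have h2 := tan_theta_mul_prob
  have h3 := prob_cubic
  have hp := (cubic_bounds h3).1
  have h4 : prob ^ 3 * (Real.tan θ ^ 3 - 2 * (1 / 2 - (1 - prob) -
      prob * (1 - prob) * (2 * prob - 1))) = 0 := by
    have : prob ^ 3 * Real.tan θ ^ 3 = (1 - prob) ^ 3 := by rw [← h2]; ring
    linear_combination this + (-2 * prob ^ 3 + prob ^ 2 + prob - 1) * h3
  have h5 := (mul_eq_zero.1 h4).resolve_left (by positivity)
  rw [κ₁, h1]
  linarith

theorem maxCHSH_mul_prob : prob * maxCHSH = 2 * prob + 4 * (1 - prob) ^ 3 := by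
  rw [maxCHSH, κ₁_eq, κ₂_eq]
  linear_combination (4 - 6 * prob) * prob_cubic

theorem abs_maxCHSH_sub_lt : |maxCHSH - 2.26977| < 0.000005 := by
  have h := prob_cubic
  have hl : 0.6477988 < prob := by
    nlinarith [sq_nonneg (prob - 1 / 3), sq_nonneg (prob + 0.6478 / 2 - 1 / 2)]
  have hu : prob < 0.6477989 := by
    nlinarith [sq_nonneg (prob - 1 / 3), sq_nonneg (prob + 0.6478 / 2 - 1 / 2)]
  rw [maxCHSH, κ₁_eq, κ₂_eq, abs_lt]
  constructor <;> nlinarith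

end Class3b

/-! ### Correlations of commuting measurements -/

section Correlation

variable {H : Type*} [NormedAddCommGroup H] [InnerProductSpace ℂ H]

/-- Two-outcome measurements of two parties, acting on a common Hilbert space. -/
structure CommutingPOVMs (M N : Fin 2 → Fin 2 → H →L[ℂ] H) : Prop where
  nonneg_left : ∀ x a, 0 ≤ M x a
  nonneg_right : ∀ y b, 0 ≤ N y b
  sum_left : ∀ x, M x 0 + M x 1 = 1
  sum_right : ∀ y, N y 0 + N y 1 = 1
  comm : ∀ x a y b, Commute (M x a) (N y b)

/-- The table `⟨ψ, M_{a|x} N_{b|y} ψ⟩`; the vector `ψ` need not be normalized. -/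
noncomputable def opCorrelation (M N : Fin 2 → Fin 2 → H →L[ℂ] H) (ψ : H) : Correlation :=
  fun a b x y => expectation ψ (M x a * N y b)

theorem chsh_eq (P : Correlation) : chsh P =
    -(P 0 0 0 0 - P 0 1 0 0 - P 1 0 0 0 + P 1 1 0 0) -
    (P 0 0 0 1 - P 0 1 0 1 - P 1 0 0 1 + P 1 1 0 1) -
    (P 0 0 1 0 - P 0 1 1 0 - P 1 0 1 0 + P 1 1 1 0) +
    (P 0 0 1 1 - P 0 1 1 1 - P 1 0 1 1 + P 1 1 1 1) := by
  simp only [chsh, Fin.sum_univ_two]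
  norm_num
  ring

namespace CommutingPOVMs

variable {M N : Fin 2 → Fin 2 → H →L[ℂ] H} (hM : CommutingPOVMs M N)

include hM

theorem left_one (x : Fin 2) : M x 1 = 1 - M x 0 := eq_sub_of_add_eq' (hM.sum_left x)

theorem left_zero (x : Fin 2) : M x 0 = 1 - M x 1 := eq_sub_of_add_eq (hM.sum_left x)

theorem right_one (y : Fin 2) : N y 1 = 1 - N y 0 := eq_sub_of_add_eq' (hM.sum_right y)

theorem right_zero (y : Fin 2) : N y 0 = 1 - N y 1 := eq_sub_of_add_eq (hM.sum_right y)

end CommutingPOVMs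

theorem HardyConfig.expectation_Q_mul_R {E Q E' R : H →L[ℂ] H} {ψ : H}
    (h : HardyConfig E Q E' R ψ) : expectation ψ (Q * R) = 0 := by
  rw [expectation_apply, mul_apply_eq_comp, h.Q_R_apply, inner_zero_right, Complex.zero_re]

variable [CompleteSpace H]

namespace CommutingPOVMs

variable {M N : Fin 2 → Fin 2 → H →L[ℂ] H} (hM : CommutingPOVMs M N)

include hM

theorem mul_nonneg (a b x y : Fin 2) : 0 ≤ M x a * N y b :=
  opNonneg_mul_of_commute (hM.nonneg_left x a) (hM.nonneg_right y b) (hM.comm x a y b)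

theorem opCorrelation_nonneg (ψ : H) (a b x y : Fin 2) : 0 ≤ opCorrelation M N ψ a b x y :=
  expectation_nonneg ψ (hM.mul_nonneg a b x y)

theorem hardyConfig {ψ : H} (h0 : HasClass3bZeros (opCorrelation M N ψ)) :
    HardyConfig (M 0 0) (M 1 1) (N 0 1) (N 1 0) ψ := by
  have key (a b x y : Fin 2) (h : opCorrelation M N ψ a b x y = 0) : M x a (N y b ψ) = 0 := by
    rw [← mul_apply_eq_comp]
    exact apply_eq_zero_of_opNonneg (hM.mul_nonneg a b x y) h
  have h1 := key _ _ _ _ h0.1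
  have h2 := key _ _ _ _ h0.2.1
  have h3 := key _ _ _ _ h0.2.2
  rw [hM.right_zero, sub_apply, one_apply_eq_self] at h1
  rw [(hM.comm _ _ _ _).clm_apply_comm, hM.left_one, sub_apply, one_apply_eq_self] at h2
  refine ⟨hM.nonneg_left _ _, ?_, hM.nonneg_left _ _, ?_, hM.nonneg_right _ _, ?_,
    hM.nonneg_right _ _, ?_, hM.comm _ _ _ _, hM.comm _ _ _ _, hM.comm _ _ _ _, hM.comm _ _ _ _,
    h1, h2, h3⟩
  · exact (hM.sum_left 0).symm ▸ le_add_of_nonneg_right (hM.nonneg_left 0 1)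
  · exact (hM.sum_left 1).symm ▸ le_add_of_nonneg_left (hM.nonneg_left 1 0)
  · exact (hM.sum_right 0).symm ▸ le_add_of_nonneg_left (hM.nonneg_right 0 0)
  · exact (hM.sum_right 1).symm ▸ le_add_of_nonneg_right (hM.nonneg_right 1 1)

end CommutingPOVMs

namespace HardyConfig

variable {E Q E' R : H →L[ℂ] H} {ψ : H} (h : HardyConfig E Q E' R ψ)

include h

theorem expectation_E : expectation ψ E = ‖ψ‖ ^ 2 - ‖ψ - E ψ‖ ^ 2 := by
  have := expectation_mul_of_selfAdjoint (v := ψ) (T := E) (.of_nonneg h.E_nonneg) rfl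
  rw [h.norm_sq_eq, add_sub_cancel_right, ← inner_self_eq_norm_sq (𝕜 := ℂ),
    RCLike.re_eq_complex_re, ← this, expectation_apply, expectation_apply, mul_apply_eq_comp,
    h.E_apply_E]

theorem expectation_E_mul_E' : expectation ψ (E * E') = ‖ψ‖ ^ 2 - ‖ψ - E ψ‖ ^ 2 := by
  rw [← h.expectation_E, expectation_apply, expectation_apply, mul_apply_eq_comp, ← h.E_apply_eq,
    h.E_apply_E]

theorem expectation_E_mul_R :
    expectation ψ (E * R) = expectation ψ R - expectation (ψ - E ψ) R := by
  have hF : IsSelfAdjoint (1 - E) := .sub (.one _) (.of_nonneg h.E_nonneg)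
  have hv : (1 - E) ψ = ψ - E ψ := by rw [sub_apply, one_apply_eq_self]
  have hv' : (1 - E) (ψ - E ψ) = ψ - E ψ := by
    rw [sub_apply, one_apply_eq_self, h.E_apply_compl, sub_zero]
  have hc : Commute (1 - E) R := (Commute.one_left _).sub_left h.comm_E_R
  have e : expectation ψ ((1 - E) * R) = expectation (ψ - E ψ) R := by
    have hR : R (ψ - E ψ) = (1 - E) (R ψ) := by rw [hc.clm_apply_comm, hv]
    rw [expectation_mul_of_selfAdjoint hF hv, expectation_apply, hR,
      ← ContinuousLinearMap.adjoint_inner_left (1 - E), hF.adjoint_eq, hv']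
  rw [← e, sub_mul, one_mul, map_sub, sub_sub_cancel]

theorem expectation_Q_mul_E' :
    expectation ψ (Q * E') = expectation ψ Q - expectation (ψ - E ψ) Q := by
  rw [h.comm_Q_E'.eq, h.symm.expectation_E_mul_R, h.E_apply_eq]

end HardyConfig

theorem chsh_opCorrelation {M N : Fin 2 → Fin 2 → H →L[ℂ] H} (hM : CommutingPOVMs M N) {ψ : H}
    (h0 : HasClass3bZeros (opCorrelation M N ψ)) :
    chsh (opCorrelation M N ψ) = 2 * ‖ψ‖ ^ 2 + 4 * (expectation (ψ - M 0 0 ψ) (M 1 1) +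
      expectation (ψ - M 0 0 ψ) (N 1 0) - ‖ψ - M 0 0 ψ‖ ^ 2) := by
  have h := hM.hardyConfig h0
  have e1 := h.expectation_E_mul_E'
  have e2 := h.expectation_E_mul_R
  have e3 := h.expectation_Q_mul_E'
  have e4 := h.expectation_Q_mul_R
  rw [chsh_eq]
  simp only [opCorrelation, hM.left_one 0, hM.left_zero 1, hM.right_zero 0, hM.right_one 1, mul_sub,
    sub_mul, one_mul, mul_one, map_sub, expectation_one]
  linarith

end Correlation

/-! ### The maximum and the correlations attaining it -/

section Maximum

variable {H : Type*} [NormedAddCommGroup H] [InnerProductSpace ℂ H] [CompleteSpace H]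

namespace HardyConfig

variable {E Q E' R : H →L[ℂ] H} {ψ : H} (h : HardyConfig E Q E' R ψ)

include h

theorem inner_compl_E_apply (v : H) : ⟪ψ - E ψ, E v⟫_ℂ = 0 := by
  rw [← ContinuousLinearMap.adjoint_inner_left, (IsSelfAdjoint.of_nonneg h.E_nonneg).adjoint_eq,
    h.E_apply_compl, inner_zero_left]

theorem inner_compl_E'_apply (v : H) : ⟪ψ - E ψ, E' v⟫_ℂ = 0 := by
  rw [h.E_apply_eq, h.symm.inner_compl_E_apply]

variable {p : ℝ} (hp : 2 * p ^ 3 - 2 * p ^ 2 + 2 * p = 1)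
  (hmax : p * (1 - p) * (expectation (ψ - E ψ) Q + expectation (ψ - E ψ) R - ‖ψ - E ψ‖ ^ 2) =
      (1 - p) ^ 4 * ‖ψ‖ ^ 2)

include hp hmax

theorem rigidity_right :
    R (ψ - E ψ) - E' (R (ψ - E ψ)) = (p : ℂ) • (ψ - E ψ) ∧
    R (R (ψ - E ψ)) = R (ψ - E ψ) := by
  rw [add_comm, h.E_apply_eq] at hmax
  rw [h.E_apply_eq]
  exact (h.symm.rigidity hp hmax).2

theorem expectation_compl_Q : expectation (ψ - E ψ) Q = p * ‖ψ - E ψ‖ ^ 2 := by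
  have h1 := eq_add_of_sub_eq' (h.rigidity hp hmax).2.1
  rw [expectation_apply, h1, inner_add_right, h.inner_compl_E_apply, zero_add, inner_smul_right,
    Complex.re_ofReal_mul, ← inner_self_eq_norm_sq (𝕜 := ℂ)]
  rfl

theorem inner_compl_Q_R :
    (⟪ψ - E ψ, Q (R (ψ - E ψ))⟫_ℂ).re = p ^ 2 * ‖ψ - E ψ‖ ^ 2 := by
  have h1 := eq_add_of_sub_eq' (h.rigidity_right hp hmax).1
  have h2 := h.expectation_compl_Q hp hmax
  rw [h1, map_add, map_smul, h.comm_Q_E'.clm_apply_comm, inner_add_right, h.inner_compl_E'_apply,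
    zero_add, inner_smul_right, Complex.re_ofReal_mul, ← expectation_apply, h2]
  ring

theorem norm_sq_compl : ‖ψ - E ψ‖ ^ 2 = p * (1 - p) * ‖ψ‖ ^ 2 := by
  have h1 := eq_neg_of_add_eq_zero_right (h.rigidity hp hmax).1
  have h2 := h.inner_E_offDiag
  rw [h1, h.inner_compl_Q_R hp hmax, inner_neg_right, inner_smul_right, Complex.neg_re,
    Complex.re_ofReal_mul] at h2
  have h3 : (⟪E ψ, E ψ⟫_ℂ).re = ‖E ψ‖ ^ 2 := inner_self_eq_norm_sq (𝕜 := ℂ) _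
  have h4 := h.norm_sq_eq
  have hu := (cubic_bounds hp).2
  have h5 : (1 - p) * (‖ψ - E ψ‖ ^ 2 - p * (1 - p) * ‖ψ‖ ^ 2) = 0 := by
    rw [h3] at h2
    linear_combination p * h2 - p * (1 - p) ^ 2 * h4 - ‖ψ - E ψ‖ ^ 2 * hp
  exact sub_eq_zero.1 ((mul_eq_zero.1 h5).resolve_left (by linarith))

theorem E'_R_apply_E : E' (R (E ψ)) = ((1 - p : ℝ) : ℂ) • E ψ := by
  have hu := (cubic_bounds hp).2
  obtain ⟨h1, h2⟩ := h.rigidity_right hp hmax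
  have h3 := eq_neg_of_add_eq_zero_left (h.rigidity hp hmax).1
  set w := ψ - E ψ
  have h4 : R (E' (R w)) = ((1 - p : ℝ) : ℂ) • R w := by
    rw [← sub_eq_iff_eq_add'.2 (sub_eq_iff_eq_add.1 h1), map_sub, h2, map_smul]
    push_cast
    module
  have h5 : E (E' (Q (R w))) = E (Q (E' (R w))) := by rw [h.comm_Q_E'.clm_apply_comm]
  refine smul_right_injective H (r := (((1 - p) ^ 2 : ℝ) : ℂ)) ?_ ?_
  · exact Complex.ofReal_ne_zero.2 (by nlinarith)
  · simp only
    rw [smul_comm, ← map_smul, ← map_smul, h3, h5, map_neg, map_neg,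
      ← h.comm_E_R.clm_apply_comm, ← h.comm_Q_R.clm_apply_comm, h4]
    rw [← h.comm_E_E'.clm_apply_comm, ← h.comm_Q_E'.clm_apply_comm]
    simp only [map_smul, smul_neg]

theorem expectation_E_mul_R_eq :
    expectation ψ (E * R) = (1 - p) * (‖ψ‖ ^ 2 - ‖ψ - E ψ‖ ^ 2) := by
  have sE := (IsSelfAdjoint.of_nonneg h.E_nonneg).adjoint_eq
  have sE' := (IsSelfAdjoint.of_nonneg h.E'_nonneg).adjoint_eq
  have h1 : ⟪E ψ, R ψ⟫_ℂ = ⟪E ψ, E' (R (E ψ))⟫_ℂ := by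
    rw [← ContinuousLinearMap.adjoint_inner_left E', sE', h.E'_apply_E,
      ← h.comm_E_R.clm_apply_comm, ← ContinuousLinearMap.adjoint_inner_left E, sE, h.E_apply_E]
  rw [expectation_mul_of_selfAdjoint (.of_nonneg h.E_nonneg) rfl, h1, h.E'_R_apply_E hp hmax,
    inner_smul_right, Complex.re_ofReal_mul, h.norm_sq_eq, add_sub_cancel_right,
    ← inner_self_eq_norm_sq (𝕜 := ℂ)]
  rfl

end HardyConfig

variable {M N : Fin 2 → Fin 2 → H →L[ℂ] H} (hM : CommutingPOVMs M N) {ψ : H}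
  (h0 : HasClass3bZeros (opCorrelation M N ψ))

include hM h0

open Class3b

theorem chsh_opCorrelation_le : chsh (opCorrelation M N ψ) ≤ maxCHSH * ‖ψ‖ ^ 2 := by
  have h1 := (hM.hardyConfig h0).hardy_bound prob_cubic
  have h2 := chsh_opCorrelation hM h0
  have h3 := maxCHSH_mul_prob
  obtain ⟨hl, hu⟩ := cubic_bounds prob_cubic
  have h4 : 0 < prob * (1 - prob) := by nlinarith
  refine le_of_mul_le_mul_left ?_ h4
  rw [h2]
  linear_combination 4 * h1 - (1 - prob) * ‖ψ‖ ^ 2 * h3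

theorem hardy_eq_of_chsh_eq (hc : chsh (opCorrelation M N ψ) = maxCHSH * ‖ψ‖ ^ 2) :
    prob * (1 - prob) * (expectation (ψ - M 0 0 ψ) (M 1 1) +
      expectation (ψ - M 0 0 ψ) (N 1 0) - ‖ψ - M 0 0 ψ‖ ^ 2) = (1 - prob) ^ 4 * ‖ψ‖ ^ 2 := by
  have h2 := chsh_opCorrelation hM h0
  have h3 := maxCHSH_mul_prob
  linear_combination prob * (1 - prob) / 4 * (hc - h2) + (1 - prob) * ‖ψ‖ ^ 2 / 4 * h3

theorem opCorrelation_eq_of_chsh_eq (hc : chsh (opCorrelation M N ψ) = maxCHSH * ‖ψ‖ ^ 2) :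
    opCorrelation M N ψ = ‖ψ‖ ^ 2 • PQ := by
  have h := hM.hardyConfig h0
  have hmax := hardy_eq_of_chsh_eq hM h0 hc
  have hmax' := hmax
  rw [add_comm, h.E_apply_eq] at hmax'
  have n1 := h.norm_sq_compl prob_cubic hmax
  have e0 := h.expectation_E
  have e0' := h.symm.expectation_E
  have e1 := h.expectation_E_mul_E'
  have e2 := h.expectation_E_mul_R
  have e2' := h.expectation_E_mul_R_eq prob_cubic hmax
  have e3 := h.symm.expectation_E_mul_R
  have e3' := h.symm.expectation_E_mul_R_eq prob_cubic hmax'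
  have e4 := h.expectation_Q_mul_R
  have e5 := h.expectation_compl_Q prob_cubic hmax
  have e6 := h.symm.expectation_compl_Q prob_cubic hmax'
  rw [← h.E_apply_eq] at e0' e3 e3' e6
  rw [← h.comm_Q_E'.eq] at e3 e3'
  have hcub := prob_cubic
  have k1 := κ₁_eq
  have k2 := κ₂_eq
  have k3 : κ₃ = (1 - 2 * κ₁ - 2 * κ₂) / 2 := rfl
  have e7 : expectation ψ (M 1 1) = (1 / 2 - κ₁) * ‖ψ‖ ^ 2 := by
    rw [k1]; linear_combination e3' - e3 + e5 + (2 * prob - 1) * n1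
  have e8 : expectation ψ (N 1 0) = (1 / 2 - κ₁) * ‖ψ‖ ^ 2 := by
    rw [k1]; linear_combination e2' - e2 + e6 + (2 * prob - 1) * n1
  have e9 : expectation ψ (M 0 0 * N 1 0) = κ₂ * ‖ψ‖ ^ 2 := by
    rw [k2]; linear_combination e2' - (1 - prob) * n1
  have e10 : expectation ψ (M 1 1 * N 0 1) = κ₂ * ‖ψ‖ ^ 2 := by
    rw [k2]; linear_combination e3' - (1 - prob) * n1
  have e11 : expectation ψ (M 0 0) = (1 / 2 + κ₂) * ‖ψ‖ ^ 2 := by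
    rw [k2]; linear_combination e0 - n1 + ‖ψ‖ ^ 2 / 2 * hcub
  have e12 : expectation ψ (N 0 1) = (1 / 2 + κ₂) * ‖ψ‖ ^ 2 := by
    rw [k2]; linear_combination e0' - n1 + ‖ψ‖ ^ 2 / 2 * hcub
  have e13 : expectation ψ (M 0 0 * N 0 1) = (1 / 2 + κ₂) * ‖ψ‖ ^ 2 := by
    rw [k2]; linear_combination e1 - n1 + ‖ψ‖ ^ 2 / 2 * hcub
  ext a b x y
  fin_cases x <;> fin_cases y <;> fin_cases a <;> fin_cases b <;>
    simp [opCorrelation, PQ, hM.left_one 0, hM.left_zero 1, hM.right_zero 0, hM.right_one 1,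
      mul_sub, sub_mul, expectation_one, e7, e8, e9, e10, e11, e12, e13, e4, k3] <;> ring

end Maximum

/-! ### Mixed states -/

section Density

variable {H : Type u} [NormedAddCommGroup H] [InnerProductSpace ℂ H]

theorem HilbertBasis.hasSum_norm_inner_sq {ι : Type*} (e : HilbertBasis ι ℂ H) (v : H) :
    HasSum (fun i => ‖⟪e i, v⟫_ℂ‖ ^ 2) (‖v‖ ^ 2) := by
  have h := Complex.hasSum_re (e.hasSum_inner_mul_inner v v)
  convert h using 2 with i
  · rw [← inner_conj_symm (e i) v, RCLike.norm_conj, Complex.mul_conj']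
    norm_cast
  · exact (inner_self_eq_norm_sq (𝕜 := ℂ) v).symm

theorem summable_norm_inner_sq {ι : Type*} (e : HilbertBasis ι ℂ H) {v : ι → H}
    (hv : Summable fun j => ‖v j‖ ^ 2) : Summable fun q : ι × ι => ‖⟪e q.1, v q.2⟫_ℂ‖ ^ 2 := by
  rw [← (Equiv.prodComm ι ι).summable_iff]
  refine (summable_prod_of_nonneg fun q => sq_nonneg _).2
    ⟨fun j => (e.hasSum_norm_inner_sq (v j)).summable, ?_⟩
  convert hv using 2 with j
  exact (e.hasSum_norm_inner_sq (v j)).tsum_eq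

/-- If `v` and `w` are square-summable families, then `∑ᵢ ∑ⱼ ⟨v j, e i⟩ ⟨e i, w j⟩` may be summed in
either order. -/
theorem hasSum_of_hasSum_swap {ι : Type*} (e : HilbertBasis ι ℂ H) {v w : ι → H}
    (hv : Summable fun j => ‖v j‖ ^ 2) (hw : Summable fun j => ‖w j‖ ^ 2) {r : ι → ℂ} {t : ℂ}
    (hr : ∀ i, HasSum (fun j => ⟪v j, e i⟫_ℂ * ⟪e i, w j⟫_ℂ) (r i)) (ht : HasSum r t) :
    HasSum (fun j => ⟪v j, w j⟫_ℂ) t := by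
  have hs : Summable fun q : ι × ι => ⟪v q.2, e q.1⟫_ℂ * ⟪e q.1, w q.2⟫_ℂ := by
    refine Summable.of_norm_bounded
      ((summable_norm_inner_sq e hv).add (summable_norm_inner_sq e hw)) fun q => ?_
    rw [norm_mul, norm_inner_symm]
    nlinarith [sq_nonneg (‖⟪e q.1, v q.2⟫_ℂ‖ - ‖⟪e q.1, w q.2⟫_ℂ‖),
      sq_nonneg ‖⟪e q.1, v q.2⟫_ℂ‖, sq_nonneg ‖⟪e q.1, w q.2⟫_ℂ‖]
  obtain ⟨S, hS⟩ := hs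
  have h1 := hS.prod_fiberwise hr
  rw [ht.unique h1]
  rw [← (Equiv.prodComm ι ι).hasSum_iff] at hS
  exact hS.prod_fiberwise fun j => e.hasSum_inner_mul_inner (v j) (w j)

variable [CompleteSpace H]

/-- A density operator `ρ` is a possibly infinite mixture of vector states: with `φᵢ = √ρ eᵢ` for a
Hilbert basis `e`, the trace of `T ρ` is the sum of the expectations of `T` in the `φᵢ`. -/
theorem IsDensityOperator.exists_decomposition {ρ : H →L[ℂ] H} (hρ : IsDensityOperator ρ) :
    ∃ (ι : Type u) (φ : ι → H), HasSum (fun i => ‖φ i‖ ^ 2) 1 ∧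
      ∀ (T : H →L[ℂ] H) (t : ℝ), IsSelfAdjoint T → HasTrace (T ∘L ρ) t →
        HasSum (fun i => expectation (φ i) T) t := by
  obtain ⟨s, e, -⟩ := exists_hilbertBasis ℂ H
  have h0 : 0 ≤ ρ := (ContinuousLinearMap.nonneg_iff_isPositive ρ).2 hρ.positive
  set σ := CFC.sqrt ρ
  have hσ : IsSelfAdjoint σ := .of_nonneg (CFC.sqrt_nonneg ρ)
  have hσσ (v : H) : σ (σ v) = ρ v := by
    rw [← mul_apply_eq_comp, CFC.sqrt_mul_sqrt_self ρ h0]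
  have h1 : HasSum (fun i => ‖σ (e i)‖ ^ 2) 1 := by
    have h := Complex.hasSum_re (hρ.trace_eq_one s e)
    convert h using 2 with i
    · rw [← hσσ, ← ContinuousLinearMap.adjoint_inner_left, hσ.adjoint_eq]
      exact (inner_self_eq_norm_sq (𝕜 := ℂ) _).symm
    · exact Complex.one_re.symm
  refine ⟨s, fun i => σ (e i), h1, fun T t hT ht => ?_⟩
  have h2 : Summable fun i => ‖T (σ (e i))‖ ^ 2 := by
    refine Summable.of_nonneg_of_le (fun i => by positivity) (fun i => ?_)
      (h1.summable.mul_left (‖T‖ ^ 2))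
    rw [← mul_pow]
    exact pow_le_pow_left₀ (norm_nonneg _) (T.le_opNorm _) 2
  have h3 := hasSum_of_hasSum_swap e h1.summable h2 (fun i => ?_) (ht s e)
  · exact Complex.hasSum_re h3
  · have h4 := e.hasSum_inner_mul_inner (σ (T (e i))) (σ (e i))
    have h5 : ⟪e i, (T ∘L ρ) (e i)⟫_ℂ = ⟪σ (T (e i)), σ (e i)⟫_ℂ := by
      rw [← ContinuousLinearMap.adjoint_inner_right σ, hσ.adjoint_eq, hσσ,
        ← ContinuousLinearMap.adjoint_inner_right T, hT.adjoint_eq]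
      rfl
    have h6 (j : s) : ⟪σ (e j), e i⟫_ℂ * ⟪e i, T (σ (e j))⟫_ℂ =
        ⟪σ (T (e i)), e j⟫_ℂ * ⟪e j, σ (e i)⟫_ℂ := by
      rw [← ContinuousLinearMap.adjoint_inner_right σ, ← ContinuousLinearMap.adjoint_inner_left T,
        ← ContinuousLinearMap.adjoint_inner_left σ, hσ.adjoint_eq, hT.adjoint_eq, mul_comm]
    simp only [h5, h6]
    exact h4

end Density

section Tensor

variable {HA HB : Type*} [NormedAddCommGroup HA] [InnerProductSpace ℂ HA]
  [NormedAddCommGroup HB] [InnerProductSpace ℂ HB]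

theorem IsPOVM.nonneg {M : Fin 2 → HA →L[ℂ] HA} (hM : IsPOVM M) (a : Fin 2) : 0 ≤ M a :=
  (ContinuousLinearMap.nonneg_iff_isPositive _).2 (hM.positive a)

theorem IsPOVM.add_eq_one {M : Fin 2 → HA →L[ℂ] HA} (hM : IsPOVM M) : M 0 + M 1 = 1 := by
  rw [← Fin.sum_univ_two, hM.sum_eq_one]

variable [CompleteSpace HA] [CompleteSpace HB]

theorem commutingPOVMs_amp {M : Fin 2 → Fin 2 → (HA →L[ℂ] HA)} {N : Fin 2 → Fin 2 → (HB →L[ℂ] HB)}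
    (hM : ∀ x, IsPOVM (M x)) (hN : ∀ y, IsPOVM (N y)) :
    CommutingPOVMs (fun x a => ampLeft HA HB (M x a)) (fun y b => ampRight HA HB (N y b)) where
  nonneg_left x a := ampLeft_nonneg ((hM x).nonneg a)
  nonneg_right y b := ampRight_nonneg ((hN y).nonneg b)
  sum_left x := by rw [← map_add, (hM x).add_eq_one, map_one]
  sum_right y := by rw [← map_add, (hN y).add_eq_one, map_one]
  comm x a y b := commute_ampLeft_ampRight _ _

theorem opCorrelation_amp (M : Fin 2 → Fin 2 → (HA →L[ℂ] HA)) (N : Fin 2 → Fin 2 → (HB →L[ℂ] HB))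
    (ψ : HilbertTensor HA HB) (a b x y : Fin 2) :
    opCorrelation (fun x a => ampLeft HA HB (M x a)) (fun y b => ampRight HA HB (N y b)) ψ a b x y =
      (⟪ψ, tensorOp (M x a) (N y b) ψ⟫_ℂ).re := by
  rw [opCorrelation, ampLeft_mul_ampRight, expectation_apply]

end Tensor

/-- Every quantum correlation is a mixture of correlations of (unnormalized) vectors. -/
theorem exists_decomposition_of_mem_quantumSet {P : Correlation} (hP : P ∈ quantumSet.{u}) :
    ∃ (H : Type u) (_ : NormedAddCommGroup H) (_ : InnerProductSpace ℂ H) (_ : CompleteSpace H)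
      (M N : Fin 2 → Fin 2 → H →L[ℂ] H) (ι : Type u) (φ : ι → H), CommutingPOVMs M N ∧
      HasSum (fun i => ‖φ i‖ ^ 2) 1 ∧
      ∀ a b x y, HasSum (fun i => opCorrelation M N (φ i) a b x y) (P a b x y) := by
  obtain ⟨HA, HB, _, _, _, _, _, _, ρ, M, N, hρ, hM, hN, h⟩ := hP
  obtain ⟨ι, φ, h1, h2⟩ := hρ.exists_decomposition
  refine ⟨_, inferInstance, inferInstance, inferInstance, _, _, ι, φ, commutingPOVMs_amp hM hN, h1,
    fun a b x y => ?_⟩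
  simp only [opCorrelation_amp]
  exact h2 _ _ (.of_nonneg (tensorOp_nonneg ((hM x).nonneg a) ((hN y).nonneg b))) (h a b x y)

theorem nonneg_of_mem_quantumSet {P : Correlation} (hP : P ∈ quantumSet.{u}) (a b x y : Fin 2) :
    0 ≤ P a b x y := by
  obtain ⟨H, _, _, _, M, N, ι, φ, hMN, -, h⟩ := exists_decomposition_of_mem_quantumSet hP
  exact (h a b x y).nonneg fun i => hMN.opCorrelation_nonneg _ _ _ _ _

open Class3b in
/-- A mixture with the zeros of Class 3b consists of vectors with these zeros, and an optimal
mixture consists of optimal vectors. -/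
theorem chsh_le_and_eq_of_mem {P : Correlation} (hP : P ∈ quantumClass3b.{u}) :
    chsh P ≤ maxCHSH ∧ (chsh P = maxCHSH → P = PQ) := by
  obtain ⟨hP, hz⟩ := hP
  obtain ⟨H, _, _, _, M, N, ι, φ, hMN, h1, h⟩ := exists_decomposition_of_mem_quantumSet hP
  have hzero (a b x y : Fin 2) (h0 : P a b x y = 0) (i : ι) :
      opCorrelation M N (φ i) a b x y = 0 := by
    have h2 := h a b x y
    rw [h0, hasSum_zero_iff_of_nonneg fun i => hMN.opCorrelation_nonneg _ _ _ _ _] at h2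
    exact congrFun h2 i
  have hz' (i : ι) : HasClass3bZeros (opCorrelation M N (φ i)) :=
    ⟨hzero _ _ _ _ hz.1 i, hzero _ _ _ _ hz.2.1 i, hzero _ _ _ _ hz.2.2 i⟩
  have hle (i : ι) := chsh_opCorrelation_le hMN (hz' i)
  have hsum : HasSum (fun i => chsh (opCorrelation M N (φ i))) (chsh P) :=
    hasSum_sum fun x _ => hasSum_sum fun y _ => hasSum_sum fun a _ => hasSum_sum fun b _ =>
      (h a b x y).mul_left _
  have hmax : HasSum (fun i => maxCHSH * ‖φ i‖ ^ 2) maxCHSH := by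
    simpa using h1.mul_left maxCHSH
  refine ⟨hasSum_le hle hsum hmax, fun heq => ?_⟩
  have h3 := hmax.sub hsum
  rw [heq, sub_self, hasSum_zero_iff_of_nonneg fun i => sub_nonneg.2 (hle i)] at h3
  have h4 (i : ι) : opCorrelation M N (φ i) = ‖φ i‖ ^ 2 • PQ :=
    opCorrelation_eq_of_chsh_eq hMN (hz' i) (sub_eq_zero.1 (congrFun h3 i)).symm
  ext a b x y
  refine (h a b x y).unique ?_
  simp only [h4]
  simpa using h1.mul_right (PQ a b x y)

/-! ### Local isometries -/

section LocalIsometry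

variable {H K : Type*} [NormedAddCommGroup H] [InnerProductSpace ℂ H] [CompleteSpace H]
  [NormedAddCommGroup K] [InnerProductSpace ℂ K]

/-- Local data extracting a qubit from the effects `E`, `Q` of one party: `Pi` is a projection onto
vectors that play the role of `k₁`, the partial isometry `U` maps its range to vectors that play the
role of `k₀`, and `Φ` maps `Pi v` to `Pi v ⊗ k₁` and `U v` to `Pi v ⊗ k₀`. In the bases `Pi v`,
`U v` the effects `E` and `Q` have the matrices of the projections onto `k₀` and onto
`√p k₁ + √(1 - p) k₀`. -/
structure ExtractsQubit (E Q : H →L[ℂ] H) (p : ℝ) (k₀ k₁ : K) (Pi U : H →L[ℂ] H)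
    (Φ : H →ₗᵢ[ℂ] HilbertTensor H K) : Prop where
  proj_apply : ∀ v, E v = 0 → Q v - E (Q v) = (p : ℂ) • v → Q (Q v) = Q v → Pi v = v
  isometry_proj : ∀ v, Φ (Pi v) = prodVec (Pi v) k₁
  isometry_partial : ∀ v, Φ (U v) = prodVec (Pi v) k₀
  E_proj : ∀ v, E (Pi v) = 0
  E_partial : ∀ v, E (U v) = U v
  Q_proj : ∀ v, Q (Pi v) = (p : ℂ) • Pi v + (√(p * (1 - p)) : ℂ) • U v
  Q_partial : ∀ v, Q (U v) = (√(p * (1 - p)) : ℂ) • Pi v + ((1 - p : ℝ) : ℂ) • U v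

theorem exists_isometry_of_partialIsometry {Pi U : H →L[ℂ] H} (hPi : star Pi = Pi)
    (hPi2 : Pi * Pi = Pi) (hUU : star U * U = Pi) (hUPi : U * Pi = U) (hPiU : Pi * U = 0)
    {k₀ k₁ : K} (h0 : ‖k₀‖ = 1) (h1 : ‖k₁‖ = 1) (h01 : ⟪k₀, k₁⟫_ℂ = 0) :
    ∃ Φ : H →ₗᵢ[ℂ] HilbertTensor H K, (∀ v, Φ (Pi v) = prodVec (Pi v) k₁) ∧
      ∀ v, Φ (U v) = prodVec (Pi v) k₀ := by
  have hUsPi : star U * Pi = 0 := by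
    have := congrArg star hPiU
    rwa [star_mul, hPi, star_zero] at this
  have hU2 : U * U = 0 := by rw [← hUPi, mul_assoc, ← mul_assoc Pi, hPiU, zero_mul, mul_zero]
  -- off the span of the ranges of `Pi` and `U`, the isometry is `v ↦ v ⊗ k₀`
  set V := star U + (1 - U * star U - Pi) with hV
  have hVV : star V * V + star Pi * Pi = 1 := by
    have e : star V = U + (1 - U * star U - Pi) := by
      rw [hV, star_add, star_star, star_sub, star_sub, star_one, star_mul, star_star, hPi]
    have z1 : U * (1 - U * star U - Pi) = 0 := by
      rw [mul_sub, mul_sub, mul_one, ← mul_assoc, hU2, zero_mul, sub_zero, hUPi, sub_self]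
    have z2 : (1 - U * star U - Pi) * star U = 0 := by
      have := congrArg star z1
      rwa [star_mul, star_sub, star_sub, star_one, star_mul, star_star, hPi, star_zero] at this
    have z3 : (1 - U * star U - Pi) * Pi = 0 := by
      rw [sub_mul, sub_mul, one_mul, hPi2, mul_assoc, hUsPi, mul_zero, sub_zero, sub_self]
    have z4 : (1 - U * star U - Pi) * (1 - U * star U - Pi) = 1 - U * star U - Pi := by
      have z5 : (1 - U * star U - Pi) * (U * star U) = 0 := by
        have z6 : (1 - U * star U - Pi) * U = 0 := by
          rw [sub_mul, sub_mul, one_mul, hPiU, mul_assoc, hUU, hUPi, sub_self, sub_zero]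
        rw [← mul_assoc, z6, zero_mul]
      rw [mul_sub, mul_sub, mul_one, z5, z3, sub_zero, sub_zero]
    rw [e, hV, add_mul, mul_add, mul_add, z1, z2, z4, hPi, hPi2]
    abel
  have hVPi : V * Pi = 0 := by
    rw [hV, add_mul, sub_mul, sub_mul, hUsPi, one_mul, mul_assoc, hUsPi, hPi2]
    simp
  have hVU : V * U = Pi := by
    rw [hV, add_mul, sub_mul, sub_mul, hUU, one_mul, mul_assoc, hUU, hUPi, hPiU]
    simp
  let L : H →L[ℂ] HilbertTensor H K := prodVecRight k₀ ∘L V + prodVecRight k₁ ∘L Pi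
  have hL (v : H) : L v = prodVec (V v) k₀ + prodVec (Pi v) k₁ := rfl
  have hnorm (v : H) : ‖L v‖ = ‖v‖ := by
    have h2 : ⟪prodVec (V v) k₀, prodVec (Pi v) k₁⟫_ℂ = 0 := by
      rw [inner_prodVec, h01, mul_zero]
    have hn (x : H) (k : K) (hk : ‖k‖ = 1) : ‖prodVec x k‖ = ‖x‖ := by
      rw [prodVec, Completion.norm_coe, TensorProduct.norm_tmul, hk, mul_one]
    have h3 := norm_add_sq_eq_norm_sq_add_norm_sq_of_inner_eq_zero _ _ h2
    rw [hn _ _ h0, hn _ _ h1, ← sq, ← sq, ← sq, ← expectation_star_mul_self,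
      ← expectation_star_mul_self, ← map_add, hVV, expectation_one] at h3
    rw [hL]
    exact (pow_left_inj₀ (norm_nonneg _) (norm_nonneg _) two_ne_zero).1 h3
  refine ⟨⟨L.toLinearMap, hnorm⟩, fun v => ?_, fun v => ?_⟩
  · change L (Pi v) = _
    rw [hL, ← mul_apply_eq_comp, hVPi, ← mul_apply_eq_comp, hPi2, zero_apply, prodVec_zero_left,
      zero_add]
  · change L (U v) = _
    rw [hL, ← mul_apply_eq_comp, hVU, ← mul_apply_eq_comp, hPiU, zero_apply, prodVec_zero_left,
      add_zero]

/-- `Pi` is the projection onto the common kernel of `E`, `Q - E Q - p` and `Q² - Q`, and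
`U = (p (1 - p))^(-1/2) E Q Pi`. -/
theorem exists_extractsQubit {E Q : H →L[ℂ] H} (hE : IsSelfAdjoint E) (hQ : IsSelfAdjoint Q)
    {p : ℝ} (hp0 : 0 < p) (hp1 : p < 1)
    {k₀ k₁ : K} (h0 : ‖k₀‖ = 1) (h1 : ‖k₁‖ = 1) (h01 : ⟪k₀, k₁⟫_ℂ = 0) :
    ∃ Pi U Φ, ExtractsQubit E Q p k₀ k₁ Pi U Φ := by
  let T : H →L[ℂ] H × H × H :=
    E.prod ((Q - E * Q - (p : ℂ) • (1 : H →L[ℂ] H)).prod (Q * Q - Q))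
  have hT (v : H) : T v = 0 ↔ E v = 0 ∧ Q v - E (Q v) = (p : ℂ) • v ∧ Q (Q v) = Q v := by
    rw [← sub_eq_zero (a := Q v - E (Q v)), ← sub_eq_zero (a := Q (Q v))]
    exact Prod.ext_iff.trans (and_congr_right fun _ => Prod.ext_iff)
  let S := LinearMap.ker T.toLinearMap
  have : CompleteSpace S := T.completeSpace_ker
  let Pi : H →L[ℂ] H := S.starProjection
  have hPi : star Pi = Pi := (isSelfAdjoint_starProjection S).star_eq
  have hPi2 : Pi * Pi = Pi := S.isIdempotentElem_starProjection
  have hmem (v : H) : E (Pi v) = 0 ∧ Q (Pi v) - E (Q (Pi v)) = (p : ℂ) • Pi v ∧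
      Q (Q (Pi v)) = Q (Pi v) := (hT _).1 (S.starProjection_apply_mem v)
  have hfix (v : H) (h1 : E v = 0) (h2 : Q v - E (Q v) = (p : ℂ) • v) (h3 : Q (Q v) = Q v) :
      Pi v = v := S.starProjection_eq_self_iff.2 ((hT v).2 ⟨h1, h2, h3⟩)
  set g := √(p * (1 - p))
  have hpos : 0 < p * (1 - p) := mul_pos hp0 (by linarith)
  have hg : (g : ℂ) ≠ 0 := Complex.ofReal_ne_zero.2 (Real.sqrt_pos.2 hpos).ne'
  have hgg : (g : ℂ) * g = p * (1 - p) := by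
    rw [← Complex.ofReal_mul, Real.mul_self_sqrt hpos.le]; push_cast; ring
  let U : H →L[ℂ] H := (g : ℂ)⁻¹ • (E * Q * Pi)
  have hU (v : H) : (g : ℂ) • U v = E (Q (Pi v)) := by
    change (g : ℂ) • ((g : ℂ)⁻¹ • E (Q (Pi v))) = _
    rw [smul_smul, mul_inv_cancel₀ hg, one_smul]
  have hPiU : Pi * U = 0 := by
    ext v
    refine ext_inner_left ℂ fun x => ?_
    rw [mul_apply_eq_comp, ← ContinuousLinearMap.adjoint_inner_left,
      ← ContinuousLinearMap.star_eq_adjoint, hPi, zero_apply, inner_zero_right]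
    have h : (g : ℂ) * ⟪Pi x, U v⟫_ℂ = 0 := by
      rw [← inner_smul_right, hU, ← ContinuousLinearMap.adjoint_inner_left, hE.adjoint_eq,
        (hmem x).1, inner_zero_left]
    exact (mul_eq_zero.1 h).resolve_left hg
  have hUPi : U * Pi = U := by rw [smul_mul_assoc, mul_assoc, hPi2]
  have hUU : star U * U = Pi := by
    ext v
    refine ext_inner_left ℂ fun x => ?_
    have e1 : ⟪Pi x, Q (Pi v)⟫_ℂ = p * ⟪Pi x, Pi v⟫_ℂ := by
      rw [eq_add_of_sub_eq' (hmem v).2.1, inner_add_right, inner_smul_right,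
        ← ContinuousLinearMap.adjoint_inner_left, hE.adjoint_eq, (hmem x).1, inner_zero_left,
        zero_add]
    have e2 : ⟪E (Q (Pi x)), E (Q (Pi v))⟫_ℂ = g * g * ⟪Pi x, Pi v⟫_ℂ := by
      rw [← sub_eq_iff_eq_add.2 (sub_eq_iff_eq_add'.1 (hmem v).2.1), inner_sub_right,
        inner_smul_right, ← ContinuousLinearMap.adjoint_inner_right E _ (Pi v), hE.adjoint_eq,
        (hmem v).1, inner_zero_right, mul_zero, sub_zero,
        ← sub_eq_iff_eq_add.2 (sub_eq_iff_eq_add'.1 (hmem x).2.1), inner_sub_left, inner_smul_left,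
        Complex.conj_ofReal, ← ContinuousLinearMap.adjoint_inner_right Q, hQ.adjoint_eq,
        (hmem v).2.2, e1, hgg]
      ring
    have e3 : (g : ℂ) * g * ⟪U x, U v⟫_ℂ = g * g * ⟪Pi x, Pi v⟫_ℂ := by
      rw [← e2, ← hU, ← hU, inner_smul_left, inner_smul_right, Complex.conj_ofReal, mul_assoc]
    have e4 := mul_left_cancel₀ (mul_ne_zero hg hg) e3
    rw [mul_apply_eq_comp, ContinuousLinearMap.star_eq_adjoint,
      ContinuousLinearMap.adjoint_inner_right, e4, ← ContinuousLinearMap.adjoint_inner_right,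
      ← ContinuousLinearMap.star_eq_adjoint, hPi, ← mul_apply_eq_comp, hPi2]
  obtain ⟨Φ, hΦ1, hΦ0⟩ := exists_isometry_of_partialIsometry hPi hPi2 hUU hUPi hPiU h0 h1 h01
  have hinj : Function.Injective fun v : H => (g : ℂ) • v := smul_right_injective H hg
  have hQPi (v : H) : Q (Pi v) = (p : ℂ) • Pi v + (g : ℂ) • U v := by
    rw [hU, ← (hmem v).2.1, sub_add_cancel]
  refine ⟨Pi, U, Φ, hfix, hΦ1, hΦ0, fun v => (hmem v).1, fun v => hinj ?_, hQPi, fun v => hinj ?_⟩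
  · simp only
    rw [← map_smul, hU, ← sub_eq_iff_eq_add.2 (sub_eq_iff_eq_add'.1 (hmem v).2.1), map_sub,
      map_smul, (hmem v).1, smul_zero, sub_zero]
    exact (sub_eq_iff_eq_add.2 (sub_eq_iff_eq_add'.1 (hmem v).2.1)).symm
  · simp only
    have e : Q ((g : ℂ) • U v) = ((1 - p : ℝ) : ℂ) • Q (Pi v) := by
      rw [hU, ← sub_eq_iff_eq_add.2 (sub_eq_iff_eq_add'.1 (hmem v).2.1), map_sub, map_smul,
        (hmem v).2.2]
      push_cast
      module
    rw [← map_smul, e, hQPi, smul_add, smul_add, smul_smul, smul_smul, smul_smul, smul_smul, hgg,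
      mul_comm (g : ℂ)]
    push_cast
    ring_nf

end LocalIsometry

/-! ### Qubit measurements -/

section Qubit

variable {K L : Type*} [NormedAddCommGroup K] [InnerProductSpace ℂ K]
  [NormedAddCommGroup L] [InnerProductSpace ℂ L]

/-- Two measurements acting on the orthonormal vectors `k₀`, `k₁` like the reference measurements of
one party: the outcome `c 0` of the setting `0` projects onto `k₀`, and the outcome `c 1` of the
setting `1` projects onto `√p k₁ + √(1 - p) k₀`. -/
structure QubitAction (M : Fin 2 → Fin 2 → K →L[ℂ] K) (c : Fin 2 → Fin 2) (p : ℝ) (k₀ k₁ : K) :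
    Prop where
  povm : ∀ x, IsPOVM (M x)
  norm_zero : ‖k₀‖ = 1
  norm_one : ‖k₁‖ = 1
  orthogonal : ⟪k₀, k₁⟫_ℂ = 0
  E_one : M 0 (c 0) k₁ = 0
  E_zero : M 0 (c 0) k₀ = k₀
  Q_one : M 1 (c 1) k₁ = (p : ℂ) • k₁ + (√(p * (1 - p)) : ℂ) • k₀
  Q_zero : M 1 (c 1) k₀ = (√(p * (1 - p)) : ℂ) • k₁ + ((1 - p : ℝ) : ℂ) • k₀

theorem IsPOVM.apply_of_ne {M : Fin 2 → K →L[ℂ] K} (hM : IsPOVM M) {a b : Fin 2} (h : a ≠ b)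
    (v : K) : M a v = v - M b v := by
  have h1 : M a + M b = 1 := by
    rw [← hM.add_eq_one]
    fin_cases a <;> fin_cases b <;> simp at h ⊢
    exact add_comm _ _
  rw [eq_sub_of_add_eq h1, sub_apply, one_apply_eq_self]

theorem QubitAction.map {M : Fin 2 → Fin 2 → K →L[ℂ] K} {c : Fin 2 → Fin 2} {p : ℝ} {k₀ k₁ : K}
    (h : QubitAction M c p k₀ k₁) (e : K ≃ₗᵢ[ℂ] L) :
    QubitAction (fun x a => e.toContinuousLinearEquiv.toContinuousLinearMap ∘L M x a ∘L
      e.symm.toContinuousLinearEquiv.toContinuousLinearMap) c p (e k₀) (e k₁) where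
  povm x := by
    refine ⟨fun a => ⟨fun v w => ?_, fun v => ?_⟩, ?_⟩
    · have := ((h.povm x).positive a).1 (e.symm v) (e.symm w)
      rw [← e.inner_map_map, ← e.inner_map_map (e.symm v)] at this
      simpa using this
    · have := ((h.povm x).positive a).2 (e.symm v)
      rw [ContinuousLinearMap.reApplyInnerSelf_apply, ← e.inner_map_map] at this
      simpa [ContinuousLinearMap.reApplyInnerSelf_apply] using this
    · ext v
      have := congrArg (fun T : K →L[ℂ] K => e (T (e.symm v))) (h.povm x).sum_eq_one
      simpa using this
  norm_zero := by rw [e.norm_map, h.norm_zero]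
  norm_one := by rw [e.norm_map, h.norm_one]
  orthogonal := by rw [e.inner_map_map, h.orthogonal]
  E_one := by simp [h.E_one]
  E_zero := by simp [h.E_zero]
  Q_one := by
    change e (M 1 (c 1) (e.symm (e k₁))) = _
    rw [e.symm_apply_apply, h.Q_one, map_add, map_smul, map_smul]
  Q_zero := by
    change e (M 1 (c 1) (e.symm (e k₀))) = _
    rw [e.symm_apply_apply, h.Q_zero, map_add, map_smul, map_smul]

/-- Extracted qubits transform like reference qubits under all effects. -/
theorem ExtractsQubit.apply_povm {H : Type*} [NormedAddCommGroup H] [InnerProductSpace ℂ H]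
    [CompleteSpace H] {M : Fin 2 → Fin 2 → H →L[ℂ] H} {N : Fin 2 → Fin 2 → K →L[ℂ] K}
    {c : Fin 2 → Fin 2} {p : ℝ} {k₀ k₁ : K} {Pi U : H →L[ℂ] H} {Φ : H →ₗᵢ[ℂ] HilbertTensor H K}
    (hM : ∀ x, IsPOVM (M x)) (hN : QubitAction N c p k₀ k₁)
    (h : ExtractsQubit (M 0 (c 0)) (M 1 (c 1)) p k₀ k₁ Pi U Φ) (x a : Fin 2) (v : H) :
    Φ (M x a (Pi v)) = prodVec (Pi v) (N x a k₁) ∧ Φ (M x a (U v)) = prodVec (Pi v) (N x a k₀) := by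
  have key (x : Fin 2) : Φ (M x (c x) (Pi v)) = prodVec (Pi v) (N x (c x) k₁) ∧
      Φ (M x (c x) (U v)) = prodVec (Pi v) (N x (c x) k₀) := by
    fin_cases x
    · simp only [Fin.zero_eta, Fin.isValue, h.E_proj, h.E_partial, hN.E_one, hN.E_zero, map_zero,
        prodVec_zero_right, h.isometry_partial, and_self]
    · simp only [Fin.mk_one, Fin.isValue, h.Q_proj, h.Q_partial, hN.Q_one, hN.Q_zero, map_add,
        map_smul, h.isometry_proj, h.isometry_partial, prodVec_add_right, prodVec_smul_right,
        and_self]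
  by_cases ha : a = c x
  · rw [ha]
    exact key x
  · rw [(hM x).apply_of_ne ha, (hM x).apply_of_ne ha, (hN.povm x).apply_of_ne ha,
      (hN.povm x).apply_of_ne ha, map_sub, map_sub, (key x).1, (key x).2, h.isometry_proj,
      h.isometry_partial, ← prodVecLeft_apply, ← prodVecLeft_apply (Pi v) (N x (c x) k₁),
      ← prodVecLeft_apply (Pi v) k₀, ← prodVecLeft_apply (Pi v) (N x (c x) k₀), ← map_sub,
      ← map_sub]
    exact ⟨rfl, rfl⟩

open Class3b

variable [CompleteSpace K] [CompleteSpace L]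

/-- Reference measurements on the state `sin θ k₁ ⊗ l₁ - cos θ k₀ ⊗ l₀` yield the correlation `PQ`:
this state attains the maximum, which determines the correlation. -/
theorem QubitAction.opCorrelation_eq {M : Fin 2 → Fin 2 → K →L[ℂ] K} {N : Fin 2 → Fin 2 → L →L[ℂ] L}
    {k₀ k₁ : K} {l₀ l₁ : L} (hM : QubitAction M ![0, 1] prob k₀ k₁)
    (hN : QubitAction N ![1, 0] prob l₀ l₁) {ψ : HilbertTensor K L}
    (hψ : ψ = (Real.sin θ : ℂ) • prodVec k₁ l₁ - (Real.cos θ : ℂ) • prodVec k₀ l₀) :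
    ‖ψ‖ = 1 ∧
    opCorrelation (fun x a => ampLeft K L (M x a)) (fun y b => ampRight K L (N y b)) ψ = PQ := by
  have hMN := commutingPOVMs_amp hM.povm hN.povm
  have hE1 : M 0 0 k₁ = 0 := hM.E_one
  have hE0 : M 0 0 k₀ = k₀ := hM.E_zero
  have hQ1 : M 1 1 k₁ = (prob : ℂ) • k₁ + (√(prob * (1 - prob)) : ℂ) • k₀ := hM.Q_one
  have hQ0 : M 1 1 k₀ = (√(prob * (1 - prob)) : ℂ) • k₁ + ((1 - prob : ℝ) : ℂ) • k₀ := hM.Q_zero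
  have hE1' : N 0 1 l₁ = 0 := hN.E_one
  have hE0' : N 0 1 l₀ = l₀ := hN.E_zero
  have hR1 : N 1 0 l₁ = (prob : ℂ) • l₁ + (√(prob * (1 - prob)) : ℂ) • l₀ := hN.Q_one
  have hR0 : N 1 0 l₀ = (√(prob * (1 - prob)) : ℂ) • l₁ + ((1 - prob : ℝ) : ℂ) • l₀ := hN.Q_zero
  obtain ⟨hl, hu⟩ := cubic_bounds prob_cubic
  have hpos : 0 ≤ prob * (1 - prob) := by nlinarith
  have hgg : ((√(prob * (1 - prob)) : ℝ) : ℂ) * √(prob * (1 - prob)) = prob * (1 - prob) := by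
    rw [← Complex.ofReal_mul, Real.mul_self_sqrt hpos]; push_cast; ring
  have hkk : ⟪k₁, k₀⟫_ℂ = 0 := inner_eq_zero_symm.1 hM.orthogonal
  have hll : ⟪l₁, l₀⟫_ℂ = 0 := inner_eq_zero_symm.1 hN.orthogonal
  have hnorm : ‖ψ‖ ^ 2 = 1 := by
    have h0 : ⟪(Real.sin θ : ℂ) • prodVec k₁ l₁, -((Real.cos θ : ℂ) • prodVec k₀ l₀)⟫_ℂ = 0 := by
      rw [inner_neg_right, inner_smul_left, inner_smul_right, inner_prodVec, hkk]
      simp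
    have hn (x : K) (y : L) : ‖prodVec x y‖ = ‖x‖ * ‖y‖ := by
      rw [prodVec, Completion.norm_coe, TensorProduct.norm_tmul]
    have h1 := norm_add_sq_eq_norm_sq_add_norm_sq_of_inner_eq_zero _ _ h0
    rw [← sub_eq_add_neg, ← hψ, norm_neg, norm_smul, norm_smul, hn, hn, hM.norm_zero, hM.norm_one,
      hN.norm_zero, hN.norm_one, Complex.norm_real, Complex.norm_real, Real.norm_eq_abs,
      Real.norm_eq_abs] at h1
    have h2 := Real.sin_sq_add_cos_sq θ
    rw [← sq_abs (Real.sin θ), ← sq_abs (Real.cos θ)] at h2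
    rw [sq, h1]
    linear_combination h2
  have hMN_apply (x a y b : Fin 2) : tensorOp (M x a) (N y b) ψ =
      (Real.sin θ : ℂ) • prodVec (M x a k₁) (N y b l₁) -
        (Real.cos θ : ℂ) • prodVec (M x a k₀) (N y b l₀) := by
    rw [hψ, map_sub, map_smul, map_smul, tensorOp_prodVec, tensorOp_prodVec]
  have hz : HasClass3bZeros
      (opCorrelation (fun x a => ampLeft K L (M x a)) (fun y b => ampRight K L (N y b)) ψ) := by
    refine ⟨?_, ?_, ?_⟩
    · rw [opCorrelation_amp, hMN_apply, (hN.povm 0).apply_of_ne (b := 1) (by simp) l₀, hE1, hE0',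
        sub_self, prodVec_zero_left, prodVec_zero_right]
      simp
    · rw [opCorrelation_amp, hMN_apply, (hM.povm 0).apply_of_ne (b := 0) (by simp) k₀, hE1', hE0,
        sub_self, prodVec_zero_left, prodVec_zero_right]
      simp
    · have e1 : (prob : ℂ) • M 1 1 k₀ = (√(prob * (1 - prob)) : ℂ) • M 1 1 k₁ := by
        rw [hQ0, hQ1, smul_add, smul_add, smul_smul, smul_smul, smul_smul, smul_smul, hgg,
          mul_comm (prob : ℂ)]
        push_cast
        rfl
      have e2 : (prob : ℂ) • N 1 0 l₀ = (√(prob * (1 - prob)) : ℂ) • N 1 0 l₁ := by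
        rw [hR0, hR1, smul_add, smul_add, smul_smul, smul_smul, smul_smul, smul_smul, hgg,
          mul_comm (prob : ℂ)]
        push_cast
        rfl
      have hp : (prob : ℂ) ≠ 0 := Complex.ofReal_ne_zero.2 (by linarith)
      have e3 : (prob : ℂ) • prodVec (M 1 1 k₀) (N 1 0 l₀) =
          ((1 - prob : ℝ) : ℂ) • prodVec (M 1 1 k₁) (N 1 0 l₁) := by
        refine smul_right_injective _ hp ?_
        simp only
        rw [← prodVec_smul_left, e1, ← prodVec_smul_right, e2, prodVec_smul_left,
          prodVec_smul_right, smul_smul, smul_smul, hgg]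
        push_cast
        rfl
      have e4 : tensorOp (M 1 1) (N 1 0) ψ = 0 := by
        refine smul_right_injective _ hp ?_
        simp only
        have e5 : (prob : ℂ) * Real.sin θ = ((1 - prob : ℝ) : ℂ) * Real.cos θ := by
          rw [← Complex.ofReal_mul, prob_mul_sin_theta, Complex.ofReal_mul]
        rw [hMN_apply, smul_sub, smul_zero, smul_comm _ (Real.cos θ : ℂ), e3, smul_smul, smul_smul,
          e5, mul_comm, sub_self]
      rw [opCorrelation_amp, e4, inner_zero_right, Complex.zero_re]
  have hw : ψ - ampLeft K L (M 0 0) ψ = (Real.sin θ : ℂ) • prodVec k₁ l₁ := by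
    rw [ampLeft_apply, hψ, map_sub, map_smul, map_smul, tensorOp_prodVec, tensorOp_prodVec, hE1,
      hE0, prodVec_zero_left, one_apply_eq_self]
    simp
  have hk : ⟪k₁, k₁⟫_ℂ = 1 := inner_self_eq_one_of_norm_eq_one hM.norm_one
  have hl' : ⟪l₁, l₁⟫_ℂ = 1 := inner_self_eq_one_of_norm_eq_one hN.norm_one
  have hexp (f : K →L[ℂ] K) (g : L →L[ℂ] L) :
      expectation ((Real.sin θ : ℂ) • prodVec k₁ l₁) (tensorOp f g) =
        prob * (1 - prob) * (⟪k₁, f k₁⟫_ℂ * ⟪l₁, g l₁⟫_ℂ).re := by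
    rw [expectation_apply, map_smul, tensorOp_prodVec, inner_smul_left, inner_smul_right,
      inner_prodVec, Complex.conj_ofReal, ← mul_assoc, ← Complex.ofReal_mul, Complex.re_ofReal_mul,
      ← sq, sin_sq_theta]
  have hc := chsh_opCorrelation hMN hz
  rw [hnorm, hw, ampLeft_apply, ampRight_apply, hexp, hexp, ← expectation_one, ← tensorOp_one,
    hexp] at hc
  simp only [one_apply_eq_self, hQ1, hR1, inner_add_right, inner_smul_right, hk, hl', hkk, hll,
    mul_zero, mul_one, add_zero, one_mul, Complex.ofReal_re, Complex.one_re] at hc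
  have hmax : chsh (opCorrelation (fun x a => ampLeft K L (M x a))
      (fun y b => ampRight K L (N y b)) ψ) = maxCHSH * ‖ψ‖ ^ 2 := by
    have h1 := maxCHSH_mul_prob
    refine mul_left_cancel₀ (by linarith : prob ≠ 0) ?_
    rw [hc, hnorm]
    linear_combination -h1 + (4 * (1 - prob)) * prob_cubic
  refine ⟨(pow_left_inj₀ (norm_nonneg _) zero_le_one two_ne_zero).1 (by rw [hnorm, one_pow]), ?_⟩
  rw [opCorrelation_eq_of_chsh_eq hMN hz hmax, hnorm, one_smul]

end Qubit

/-! ### The reference strategy -/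

theorem ofReal_expectation {H : Type*} [NormedAddCommGroup H] [InnerProductSpace ℂ H]
    {T : H →L[ℂ] H} (hT : 0 ≤ T) (v : H) : ((expectation v T : ℝ) : ℂ) = ⟪v, T v⟫_ℂ := by
  have h := ((ContinuousLinearMap.nonneg_iff_isPositive T).1 hT).inner_nonneg_right v
  exact (Complex.eq_re_of_ofReal_le h).symm

theorem PureStrategy.realizes_iff {HA HB : Type*} [NormedAddCommGroup HA] [InnerProductSpace ℂ HA]
    [CompleteSpace HA] [NormedAddCommGroup HB] [InnerProductSpace ℂ HB] [CompleteSpace HB]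
    (S : PureStrategy HA HB) (P : Correlation) : S.Realizes P ↔
      ‖S.state‖ = 1 ∧ (∀ x, IsPOVM (S.measA x)) ∧ (∀ y, IsPOVM (S.measB y)) ∧
      opCorrelation (fun x a => ampLeft HA HB (S.measA x a))
        (fun y b => ampRight HA HB (S.measB y b)) S.state = P := by
  constructor
  · intro h
    refine ⟨h.norm_state, h.povmA, h.povmB, ?_⟩
    ext a b x y
    rw [opCorrelation_amp, ← h.born, Complex.ofReal_re]
  · rintro ⟨h1, h2, h3, rfl⟩
    refine ⟨h1, h2, h3, fun a b x y => ?_⟩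
    rw [opCorrelation_amp, ← expectation_apply, ofReal_expectation]
    exact tensorOp_nonneg ((h2 x).nonneg a) ((h3 y).nonneg b)

/-- Correlations of pure-state strategies are quantum: take the projection onto the state. -/
theorem PureStrategy.Realizes.mem_quantumSet {HA HB : Type u} [NormedAddCommGroup HA]
    [InnerProductSpace ℂ HA] [CompleteSpace HA] [NormedAddCommGroup HB] [InnerProductSpace ℂ HB]
    [CompleteSpace HB] {S : PureStrategy HA HB} {P : Correlation} (h : S.Realizes P) :
    P ∈ quantumSet.{u} := by
  have key (T : HilbertTensor HA HB →L[ℂ] HilbertTensor HA HB) :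
      HasTrace (T ∘L InnerProductSpace.rankOne ℂ S.state S.state) ⟪S.state, T S.state⟫_ℂ := by
    intro ι e
    have h1 := e.hasSum_inner_mul_inner S.state (T S.state)
    have h2 (i : ι) : ⟪e i, (T ∘L InnerProductSpace.rankOne ℂ S.state S.state) (e i)⟫_ℂ =
        ⟪S.state, e i⟫_ℂ * ⟪e i, T S.state⟫_ℂ := by
      rw [ContinuousLinearMap.comp_apply, InnerProductSpace.rankOne_apply, map_smul,
        inner_smul_right]
    simpa only [h2] using h1
  refine ⟨HA, HB, _, _, ‹_›, _, _, ‹_›, InnerProductSpace.rankOne ℂ S.state S.state, S.measA,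
    S.measB, ⟨InnerProductSpace.isPositive_rankOne_self _, ?_⟩, h.povmA, h.povmB,
    fun a b x y => ?_⟩
  · have := key 1
    rwa [one_apply_eq_self, inner_self_eq_one_of_norm_eq_one h.norm_state] at this
  · rw [h.born]
    exact key _

namespace Class3b

theorem effect_apply (O : Matrix (Fin 2) (Fin 2) ℂ) (a : Fin 2) (v : Qubit) (i : Fin 2) :
    effect O a v i = 1 / 2 * (v i + (-1) ^ (a : ℕ) * (O i 0 * v 0 + O i 1 * v 1)) := by
  rw [effect, Matrix.ofLp_toEuclideanCLM, Matrix.smul_mulVec, Matrix.add_mulVec,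
    Matrix.one_mulVec, Matrix.smul_mulVec]
  fin_cases i <;> simp [Matrix.vecHead, Matrix.vecTail]

theorem isPOVM_effect {O : Matrix (Fin 2) (Fin 2) ℂ} (hO : star O = O) (hOO : O * O = 1) :
    IsPOVM (effect O) := by
  refine ⟨fun a => ContinuousLinearMap.IsPositive.of_isStarProjection ?_, ?_⟩
  · have hε : (-1 : ℂ) ^ (a : ℕ) * (-1) ^ (a : ℕ) = 1 := by
      rw [← mul_pow]; norm_num
    have hε' : star ((-1 : ℂ) ^ (a : ℕ)) = (-1) ^ (a : ℕ) := by simp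
    refine IsStarProjection.map ⟨?_, ?_⟩ _
    · rw [IsIdempotentElem, smul_mul_smul_comm, mul_add, add_mul, add_mul, smul_mul_smul_comm, hOO,
        hε]
      simp only [one_mul, mul_one, one_smul]
      module
    · rw [isSelfAdjoint_iff, star_smul, star_add, star_smul, hO, hε', star_one]
      simp
  · rw [Fin.sum_univ_two, effect, effect, ← map_add,
      ← map_one (Matrix.toEuclideanCLM (n := Fin 2) (𝕜 := ℂ))]
    congr 1
    simp only [Fin.val_zero, Fin.val_one, pow_zero, pow_one]
    module

theorem star_observable (c s : ℝ) : star (observable c s) = observable c s := by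
  ext i j
  fin_cases i <;> fin_cases j <;> simp [observable, σz, σx, Matrix.star_apply]

theorem observable_mul_self {c s : ℝ} (h : c ^ 2 + s ^ 2 = 1) :
    observable c s * observable c s = 1 := by
  have h' : (c : ℂ) ^ 2 + s ^ 2 = 1 := by exact_mod_cast h
  ext i j
  fin_cases i <;> fin_cases j <;>
    simp [observable, σz, σx, Matrix.mul_apply, Fin.sum_univ_two] <;>
    first
    | linear_combination h'
    | ring

theorem isPOVM_effect_observable {c s : ℝ} (h : c ^ 2 + s ^ 2 = 1) :
    IsPOVM (effect (observable c s)) :=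
  isPOVM_effect (star_observable c s) (observable_mul_self h)

theorem σz_eq : σz = observable 1 0 := by simp [observable]

theorem effect_σz_zero : effect σz 0 (ket 0) = ket 0 ∧ effect σz 0 (ket 1) = 0 ∧
    effect σz 1 (ket 0) = 0 ∧ effect σz 1 (ket 1) = ket 1 := by
  refine ⟨?_, ?_, ?_, ?_⟩ <;> ext i <;> rw [effect_apply] <;> fin_cases i <;>
    simp [ket, σz] <;> norm_num

theorem qubitAction_obsA : QubitAction reference.measA ![0, 1] prob (ket 0) (ket 1) where
  povm x := by
    fin_cases x
    · change IsPOVM (effect σz)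
      rw [σz_eq]
      exact isPOVM_effect_observable (by norm_num)
    · exact isPOVM_effect_observable (by rw [neg_sq]; exact Real.cos_sq_add_sin_sq _)
  norm_zero := by simp [ket]
  norm_one := by simp [ket]
  orthogonal := by simp [ket, EuclideanSpace.inner_single_left]
  E_one := effect_σz_zero.2.1
  E_zero := effect_σz_zero.1
  Q_one := by
    change effect (observable (Real.cos (2 * α)) (-Real.sin (2 * α))) 1 (ket 1) = _
    rw [cos_two_alpha, sin_two_alpha]
    ext i
    rw [effect_apply]
    fin_cases i <;> simp [ket, observable, σz, σx]
  Q_zero := by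
    change effect (observable (Real.cos (2 * α)) (-Real.sin (2 * α))) 1 (ket 0) = _
    rw [cos_two_alpha, sin_two_alpha]
    ext i
    rw [effect_apply]
    fin_cases i <;> simp [ket, observable, σz, σx]
    ring

theorem qubitAction_obsB : QubitAction reference.measB ![1, 0] prob (-ket 1) (ket 0) where
  povm y := by
    fin_cases y
    · change IsPOVM (effect σz)
      rw [σz_eq]
      exact isPOVM_effect_observable (by norm_num)
    · exact isPOVM_effect_observable (by rw [neg_sq, neg_sq]; exact Real.cos_sq_add_sin_sq _)
  norm_zero := by simp [ket]
  norm_one := by simp [ket]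
  orthogonal := by simp [ket, EuclideanSpace.inner_single_left]
  E_one := effect_σz_zero.2.2.1
  E_zero := by rw [map_neg]; exact congrArg _ effect_σz_zero.2.2.2
  Q_one := by
    change effect (observable (-Real.cos (2 * β)) (-Real.sin (2 * β))) 0 (ket 0) = _
    rw [cos_two_beta, sin_two_beta]
    ext i
    rw [effect_apply]
    fin_cases i <;> simp [ket, observable, σz, σx]
  Q_zero := by
    change effect (observable (-Real.cos (2 * β)) (-Real.sin (2 * β))) 0 (-ket 1) = _
    rw [cos_two_beta, sin_two_beta]
    ext i
    rw [effect_apply]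
    fin_cases i <;> simp [ket, observable, σz, σx]
    ring

theorem reference_state : reference.state = (Real.sin θ : ℂ) • prodVec (ket 1) (ket 0) -
    (Real.cos θ : ℂ) • prodVec (ket 0) (-ket 1) := by
  have : prodVec (ket 0) (-ket 1) = -prodVec (ket 0) (ket 1) := map_neg (prodVecLeft (ket 0)) _
  rw [this, smul_neg, sub_neg_eq_add, add_comm]
  rfl

theorem reference_realizes : reference.Realizes PQ := by
  obtain ⟨h1, h2⟩ := qubitAction_obsA.opCorrelation_eq qubitAction_obsB reference_state
  exact (PureStrategy.realizes_iff _ _).2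
    ⟨h1, qubitAction_obsA.povm, qubitAction_obsB.povm, h2⟩

/-- The reference strategy, transported to a qubit space in the universe `u`, shows that `PQ` is
quantum. -/
theorem PQ_mem_quantumSet : PQ ∈ quantumSet.{u} := by
  let e : Qubit ≃ₗᵢ[ℂ] EuclideanSpace ℂ (ULift.{u} (Fin 2)) :=
    LinearIsometryEquiv.piLpCongrLeft 2 ℂ ℂ Equiv.ulift.symm
  have hA := qubitAction_obsA.map e
  have hB := qubitAction_obsB.map e
  obtain ⟨h1, h2⟩ := hA.opCorrelation_eq hB rfl
  exact ((PureStrategy.realizes_iff ⟨_, _, _⟩ _).2 ⟨h1, hA.povm, hB.povm, h2⟩).mem_quantumSet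

end Class3b

/-! ### Self-testing -/

section SelfTest

variable {H L K : Type*} [NormedAddCommGroup H] [InnerProductSpace ℂ H] [CompleteSpace H]
  [NormedAddCommGroup L] [InnerProductSpace ℂ L] [CompleteSpace L]
  [NormedAddCommGroup K] [InnerProductSpace ℂ K]

namespace ExtractsQubit

omit [CompleteSpace H] in
theorem E_mul_Q_mul_proj {E Q : H →L[ℂ] H} {p : ℝ} {k₀ k₁ : K} {Pi U : H →L[ℂ] H}
    {Φ : H →ₗᵢ[ℂ] HilbertTensor H K} (h : ExtractsQubit E Q p k₀ k₁ Pi U Φ) :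
    E * Q * Pi = (√(p * (1 - p)) : ℂ) • U := by
  ext v
  change E (Q (Pi v)) = (√(p * (1 - p)) : ℂ) • U v
  rw [h.Q_proj, map_add, map_smul, map_smul, h.E_proj, h.E_partial, smul_zero, zero_add]

theorem ampLeft_proj {E Q : H →L[ℂ] H} {p : ℝ} {k₀ k₁ : K} {Pi U : H →L[ℂ] H}
    {Φ : H →ₗᵢ[ℂ] HilbertTensor H K} (h : ExtractsQubit E Q p k₀ k₁ Pi U Φ)
    {w : HilbertTensor H L} (h1 : ampLeft H L E w = 0)
    (h2 : ampLeft H L Q w - ampLeft H L E (ampLeft H L Q w) = (p : ℂ) • w)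
    (h3 : ampLeft H L Q (ampLeft H L Q w) = ampLeft H L Q w) : ampLeft H L Pi w = w := by
  refine ampLeft_apply_eq_self (T := ![E, Q - E * Q - (p : ℂ) • 1, Q * Q - Q])
    (fun x hx => ?_) fun i => ?_
  · have x1 : E x = 0 := hx 0
    have x2 : Q x - E (Q x) - (p : ℂ) • x = 0 := hx 1
    have x3 : Q (Q x) - Q x = 0 := hx 2
    exact h.proj_apply x x1 (sub_eq_zero.1 x2) (sub_eq_zero.1 x3)
  · fin_cases i
    · exact h1
    · change ampLeft H L (Q - E * Q - (p : ℂ) • 1) w = 0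
      have e : ampLeft H L ((p : ℂ) • 1) w = (p : ℂ) • w := by
        rw [ampLeft_apply, tensorOp_smul_left, tensorOp_one]; rfl
      rw [map_sub, map_sub, map_mul, sub_apply, sub_apply, mul_apply_eq_comp, h2, e, sub_self]
    · change ampLeft H L (Q * Q - Q) w = 0
      rw [map_sub, map_mul, sub_apply, mul_apply_eq_comp, h3, sub_self]

theorem ampRight_proj {E Q : L →L[ℂ] L} {p : ℝ} {k₀ k₁ : K} {Pi U : L →L[ℂ] L}
    {Φ : L →ₗᵢ[ℂ] HilbertTensor L K} (h : ExtractsQubit E Q p k₀ k₁ Pi U Φ)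
    {w : HilbertTensor H L} (h1 : ampRight H L E w = 0)
    (h2 : ampRight H L Q w - ampRight H L E (ampRight H L Q w) = (p : ℂ) • w)
    (h3 : ampRight H L Q (ampRight H L Q w) = ampRight H L Q w) : ampRight H L Pi w = w := by
  refine ampRight_apply_eq_self (T := ![E, Q - E * Q - (p : ℂ) • 1, Q * Q - Q])
    (fun x hx => ?_) fun i => ?_
  · have x1 : E x = 0 := hx 0
    have x2 : Q x - E (Q x) - (p : ℂ) • x = 0 := hx 1
    have x3 : Q (Q x) - Q x = 0 := hx 2
    exact h.proj_apply x x1 (sub_eq_zero.1 x2) (sub_eq_zero.1 x3)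
  · fin_cases i
    · exact h1
    · change ampRight H L (Q - E * Q - (p : ℂ) • 1) w = 0
      have e : ampRight H L ((p : ℂ) • 1) w = (p : ℂ) • w := by
        rw [ampRight_apply, tensorOp_smul_right, tensorOp_one]; rfl
      rw [map_sub, map_sub, map_mul, sub_apply, sub_apply, mul_apply_eq_comp, h2, e, sub_self]
    · change ampRight H L (Q * Q - Q) w = 0
      rw [map_sub, map_mul, sub_apply, mul_apply_eq_comp, h3, sub_self]

end ExtractsQubit

variable {K' : Type*} [NormedAddCommGroup K'] [InnerProductSpace ℂ K']

namespace ExtractsQubit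

theorem offDiag_apply {E Q : H →L[ℂ] H} {E' R : L →L[ℂ] L} {p : ℝ} (hp : 0 ≤ p * (1 - p))
    {k₀ k₁ : K} {l₀ l₁ : K'} {Pi U : H →L[ℂ] H} {Pi' U' : L →L[ℂ] L}
    {Φ : H →ₗᵢ[ℂ] HilbertTensor H K} {Φ' : L →ₗᵢ[ℂ] HilbertTensor L K'}
    (h : ExtractsQubit E Q p k₀ k₁ Pi U Φ) (h' : ExtractsQubit E' R p l₀ l₁ Pi' U' Φ')
    {w : HilbertTensor H L} (hw : tensorOp Pi Pi' w = w) :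
    ampLeft H L E (ampRight H L E' (ampLeft H L Q (ampRight H L R w))) =
      ((p * (1 - p) : ℝ) : ℂ) • tensorOp U U' w := by
  have hgg : (√(p * (1 - p)) : ℂ) * √(p * (1 - p)) = ((p * (1 - p) : ℝ) : ℂ) := by
    rw [← Complex.ofReal_mul, Real.mul_self_sqrt hp]
  have e : ampLeft H L E * ampRight H L E' * (ampLeft H L Q * ampRight H L R) * tensorOp Pi Pi' =
      ((p * (1 - p) : ℝ) : ℂ) • tensorOp U U' := by
    rw [ampLeft_mul_ampRight, ampLeft_mul_ampRight, ← tensorOp_mul, ← tensorOp_mul,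
      h.E_mul_Q_mul_proj, h'.E_mul_Q_mul_proj, tensorOp_smul_left, tensorOp_smul_right, smul_smul,
      hgg]
  have e' := DFunLike.congr_fun e w
  rwa [mul_apply_eq_comp, hw, mul_apply_eq_comp, mul_apply_eq_comp, mul_apply_eq_comp,
    smul_apply] at e'

/-- The local isometries carry the action of the effects over to the qubit factors. -/
theorem tensorOp_povm {M : Fin 2 → Fin 2 → H →L[ℂ] H} {N : Fin 2 → Fin 2 → L →L[ℂ] L}
    {M' : Fin 2 → Fin 2 → K →L[ℂ] K} {N' : Fin 2 → Fin 2 → K' →L[ℂ] K'} {c d : Fin 2 → Fin 2}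
    {p : ℝ} {k₀ k₁ : K} {l₀ l₁ : K'} {Pi U : H →L[ℂ] H} {Pi' U' : L →L[ℂ] L}
    {Φ : H →ₗᵢ[ℂ] HilbertTensor H K} {Φ' : L →ₗᵢ[ℂ] HilbertTensor L K'}
    (hM : ∀ x, IsPOVM (M x)) (hN : ∀ y, IsPOVM (N y))
    (hM' : QubitAction M' c p k₀ k₁) (hN' : QubitAction N' d p l₀ l₁)
    (h : ExtractsQubit (M 0 (c 0)) (M 1 (c 1)) p k₀ k₁ Pi U Φ)
    (h' : ExtractsQubit (N 0 (d 0)) (N 1 (d 1)) p l₀ l₁ Pi' U' Φ')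
    {w : HilbertTensor H L} (hw : tensorOp Pi Pi' w = w) (x a y b : Fin 2) :
    tensorOp Φ.toContinuousLinearMap Φ'.toContinuousLinearMap (tensorOp (M x a) (N y b) w) =
      tensorOp (prodVecRight (M' x a k₁)) (prodVecRight (N' y b l₁)) w ∧
    tensorOp Φ.toContinuousLinearMap Φ'.toContinuousLinearMap
        (tensorOp (M x a) (N y b) (tensorOp U U' w)) =
      tensorOp (prodVecRight (M' x a k₀)) (prodVecRight (N' y b l₀)) w := by
  have e1 : (Φ.toContinuousLinearMap ∘L M x a) ∘L Pi = prodVecRight (M' x a k₁) ∘L Pi :=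
    ContinuousLinearMap.ext fun v => (h.apply_povm hM hM' x a v).1
  have e2 : (Φ'.toContinuousLinearMap ∘L N y b) ∘L Pi' = prodVecRight (N' y b l₁) ∘L Pi' :=
    ContinuousLinearMap.ext fun v => (h'.apply_povm hN hN' y b v).1
  have e3 : (Φ.toContinuousLinearMap ∘L M x a) ∘L U = prodVecRight (M' x a k₀) ∘L Pi :=
    ContinuousLinearMap.ext fun v => (h.apply_povm hM hM' x a v).2
  have e4 : (Φ'.toContinuousLinearMap ∘L N y b) ∘L U' = prodVecRight (N' y b l₀) ∘L Pi' :=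
    ContinuousLinearMap.ext fun v => (h'.apply_povm hN hN' y b v).2
  constructor
  · conv_lhs => rw [← hw]
    rw [tensorOp_tensorOp, tensorOp_tensorOp, e1, e2, ← tensorOp_tensorOp, hw]
  · rw [tensorOp_tensorOp, tensorOp_tensorOp, e3, e4, ← tensorOp_tensorOp, hw]

end ExtractsQubit

end SelfTest

theorem ContinuousLinearMap.map_smul_sub_smul {V W : Type*} [NormedAddCommGroup V]
    [NormedSpace ℂ V] [NormedAddCommGroup W] [NormedSpace ℂ W] (f : V →L[ℂ] W) (s t : ℂ) (x y : V) :
    f (s • x - t • y) = s • f x - t • f y := by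
  rw [map_sub, map_smul, map_smul]

theorem junkTensor_smul_sub_smul {A B C D : Type*} [NormedAddCommGroup A] [InnerProductSpace ℂ A]
    [NormedAddCommGroup B] [InnerProductSpace ℂ B] [NormedAddCommGroup C] [InnerProductSpace ℂ C]
    [NormedAddCommGroup D] [InnerProductSpace ℂ D] (s t : ℂ) (ς : HilbertTensor A B)
    (k k' : C) (l l' : D) :
    junkTensor ς (s • prodVec k l - t • prodVec k' l') =
      s • tensorOp (prodVecRight k) (prodVecRight l) ς -
        t • tensorOp (prodVecRight k') (prodVecRight l') ς := by
  rw [tensorOp_prodVecRight, tensorOp_prodVecRight]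
  exact ContinuousLinearMap.map_smul_sub_smul _ s t _ _

section Reference

open Class3b

/-- The state of an optimal strategy is `sin θ ς - cos θ (U ⊗ U') ς` with a unit vector `ς` in the
range of `Pi ⊗ Pi'`, where `Pi`, `U`, `Pi'`, `U'` are the operators extracting the local qubits. -/
theorem PureStrategy.exists_extractsQubit_of_chsh_eq {HA HB : Type*} [NormedAddCommGroup HA]
    [InnerProductSpace ℂ HA] [CompleteSpace HA] [NormedAddCommGroup HB] [InnerProductSpace ℂ HB]
    [CompleteSpace HB] {S : PureStrategy HA HB} {P : Correlation} (hS : S.Realizes P)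
    (h0 : HasClass3bZeros P) (hc : chsh P = maxCHSH) :
    ∃ Pi U Φ Pi' U' Φ', ∃ ς : HilbertTensor HA HB,
      ExtractsQubit (S.measA 0 0) (S.measA 1 1) prob (ket 0) (ket 1) Pi U Φ ∧
      ExtractsQubit (S.measB 0 1) (S.measB 1 0) prob (-ket 1) (ket 0) Pi' U' Φ' ∧
      tensorOp Pi Pi' ς = ς ∧ ‖ς‖ = 1 ∧
      S.state = (Real.sin θ : ℂ) • ς - (Real.cos θ : ℂ) • tensorOp U U' ς := by
  obtain ⟨hn, hA, hB, rfl⟩ := (S.realizes_iff P).1 hS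
  have hM := commutingPOVMs_amp hA hB
  have h := hM.hardyConfig h0
  have hmax := hardy_eq_of_chsh_eq hM h0 (by rw [hc, hn, one_pow, mul_one])
  obtain ⟨r1, r2, r3⟩ := h.rigidity prob_cubic hmax
  obtain ⟨r4, r5⟩ := h.rigidity_right prob_cubic hmax
  have r6 := h.norm_sq_compl prob_cubic hmax
  have r7 := h.E_apply_compl
  have r8 := h.E'_apply_sub
  have hψ : S.state = ampLeft HA HB (S.measA 0 0) S.state +
    (S.state - ampLeft HA HB (S.measA 0 0) S.state) := (add_sub_cancel _ _).symm
  obtain ⟨hl, hu⟩ := cubic_bounds prob_cubic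
  have hpos : 0 ≤ prob * (1 - prob) := by nlinarith
  have hq : ((1 - prob : ℝ) : ℂ) ≠ 0 := Complex.ofReal_ne_zero.2 (by linarith)
  have hs : (Real.sin θ : ℂ) ≠ 0 := Complex.ofReal_ne_zero.2 sin_theta_pos.ne'
  have hsc : (prob : ℂ) * Real.sin θ = ((1 - prob : ℝ) : ℂ) * Real.cos θ := by
    rw [← Complex.ofReal_mul, prob_mul_sin_theta, Complex.ofReal_mul]
  obtain ⟨Pi, U, Φ, X⟩ := exists_extractsQubit (.of_nonneg ((hA 0).nonneg 0))
    (.of_nonneg ((hA 1).nonneg 1)) (by linarith) (by linarith) qubitAction_obsA.norm_zero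
    qubitAction_obsA.norm_one qubitAction_obsA.orthogonal (p := prob)
  obtain ⟨Pi', U', Φ', X'⟩ := exists_extractsQubit (.of_nonneg ((hB 0).nonneg 1))
    (.of_nonneg ((hB 1).nonneg 0)) (by linarith) (by linarith) qubitAction_obsB.norm_zero
    qubitAction_obsB.norm_one qubitAction_obsB.orthogonal (p := prob)
  have hPi : tensorOp Pi Pi' (S.state - ampLeft HA HB (S.measA 0 0) S.state) =
      S.state - ampLeft HA HB (S.measA 0 0) S.state := by
    rw [← ampLeft_mul_ampRight, mul_apply_eq_comp, X'.ampRight_proj r8 r4 r5,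
      X.ampLeft_proj r7 r2 r3]
  refine ⟨Pi, U, Φ, Pi', U', Φ',
    (Real.sin θ : ℂ)⁻¹ • (S.state - ampLeft HA HB (S.measA 0 0) S.state), X, X',
    by rw [map_smul, hPi], ?_, ?_⟩
  · rw [hn, one_pow, mul_one, ← sin_sq_theta] at r6
    rw [norm_smul, norm_inv, Complex.norm_real, Real.norm_of_nonneg sin_theta_pos.le,
      (pow_left_inj₀ (norm_nonneg _) sin_theta_pos.le two_ne_zero).1 r6,
      inv_mul_cancel₀ sin_theta_pos.ne']
  · rw [X.offDiag_apply hpos X' hPi] at r1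
    generalize S.state - ampLeft HA HB (S.measA 0 0) S.state = w at *
    have hU : ((1 - prob : ℝ) : ℂ) • ampLeft HA HB (S.measA 0 0) S.state =
        -((prob : ℂ) • tensorOp U U' w) := by
      refine smul_right_injective _ hq (eq_neg_of_add_eq_zero_left ?_ |>.trans (smul_neg _ _).symm)
      simp only
      rw [smul_smul, smul_smul, ← Complex.ofReal_mul, ← Complex.ofReal_mul, ← sq,
        mul_comm (1 - prob) prob]
      exact r1
    refine smul_right_injective _ hq ?_
    conv_lhs => rw [hψ]
    simp only
    rw [smul_add, hU, neg_add_eq_sub, map_smul, smul_sub, smul_smul _ (Real.sin θ : ℂ)⁻¹,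
      mul_inv_cancel₀ hs, one_smul, smul_smul, smul_smul, ← hsc, mul_assoc,
      mul_inv_cancel₀ hs, mul_one]

/-- The local isometries take the vectors `ς` and `(U ⊗ U') ς` of the decomposition of the state to
`ς ⊗ (k₁ ⊗ l₁)` and `ς ⊗ (k₀ ⊗ l₀)`, and the effects act on the qubit factors only. -/
theorem PureStrategy.equiv_reference_of_chsh_eq {HA HB : Type u} [NormedAddCommGroup HA]
    [InnerProductSpace ℂ HA] [CompleteSpace HA] [NormedAddCommGroup HB] [InnerProductSpace ℂ HB]
    [CompleteSpace HB] {S : PureStrategy HA HB} {P : Correlation} (hS : S.Realizes P)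
    (h0 : HasClass3bZeros P) (hc : chsh P = maxCHSH) : S.EquivUpToLocalIsometries reference := by
  obtain ⟨Pi, U, Φ, Pi', U', Φ', ς, X, X', hPi, hς, hψ⟩ := exists_extractsQubit_of_chsh_eq hS h0 hc
  refine ⟨HA, HB, _, _, ‹_›, _, _, ‹_›, Φ, Φ', ς, hς, fun a b x y => ?_⟩
  obtain ⟨h1, h2⟩ := X.tensorOp_povm (c := ![0, 1]) (d := ![1, 0]) hS.povmA hS.povmB
    qubitAction_obsA qubitAction_obsB X' hPi x a y b
  rw [reference_state, ContinuousLinearMap.map_smul_sub_smul, tensorOp_prodVec, tensorOp_prodVec,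
    junkTensor_smul_sub_smul, ← h1, ← h2, hψ, ContinuousLinearMap.map_smul_sub_smul,
    ContinuousLinearMap.map_smul_sub_smul]

end Reference

/-! ### The maximum over Class 3b -/

namespace Class3b

theorem hasClass3bZeros_PQ : HasClass3bZeros PQ := by
  simp [HasClass3bZeros, PQ]

theorem PQ_mem_quantumClass3b : PQ ∈ quantumClass3b.{u} := ⟨PQ_mem_quantumSet, hasClass3bZeros_PQ⟩

theorem chsh_PQ : chsh PQ = maxCHSH := by
  simp [chsh, Fin.sum_univ_two, PQ, maxCHSH, κ₃]
  ring

theorem chsh_eq_max_iff {P : Correlation} (hP : P ∈ quantumClass3b.{u}) :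
    chsh P = maxCHSH ↔ P = PQ :=
  ⟨(chsh_le_and_eq_of_mem hP).2, fun h => h ▸ chsh_PQ⟩

theorem chsh_add_smul (s t : ℝ) (P Q : Correlation) :
    chsh (s • P + t • Q) = s * chsh P + t * chsh Q := by
  simp only [chsh, Finset.mul_sum, ← Finset.sum_add_distrib, Pi.add_apply, Pi.smul_apply,
    smul_eq_mul]
  refine Finset.sum_congr rfl fun x _ => Finset.sum_congr rfl fun y _ =>
    Finset.sum_congr rfl fun a _ => Finset.sum_congr rfl fun b _ => by ring

/-- A decomposition of `PQ` inherits its zeros, since probabilities are nonnegative, and its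
optimality, since the CHSH value is affine; both parts are therefore `PQ` by uniqueness. -/
theorem PQ_mem_extremePoints : PQ ∈ Set.extremePoints ℝ quantumSet.{u} := by
  refine ⟨PQ_mem_quantumSet, fun P hP P' hP' h => ?_⟩
  obtain ⟨s, t, hs, ht, hst, h⟩ := h
  have zero (a b x y : Fin 2) (hz : PQ a b x y = 0) : P a b x y = 0 ∧ P' a b x y = 0 := by
    have h1 : s * P a b x y + t * P' a b x y = 0 := by
      rw [← hz, ← h]; rfl
    have h2 := mul_nonneg hs.le (nonneg_of_mem_quantumSet hP a b x y)
    have h3 := mul_nonneg ht.le (nonneg_of_mem_quantumSet hP' a b x y)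
    exact ⟨(mul_eq_zero.1 (by linarith)).resolve_left hs.ne',
      (mul_eq_zero.1 (by linarith)).resolve_left ht.ne'⟩
  obtain ⟨z1, z2, z3⟩ := hasClass3bZeros_PQ
  obtain ⟨b1, c1⟩ := chsh_le_and_eq_of_mem
    ⟨hP, (zero _ _ _ _ z1).1, (zero _ _ _ _ z2).1, (zero _ _ _ _ z3).1⟩
  obtain ⟨b2, -⟩ := chsh_le_and_eq_of_mem
    ⟨hP', (zero _ _ _ _ z1).2, (zero _ _ _ _ z2).2, (zero _ _ _ _ z3).2⟩
  have h4 : s * chsh P + t * chsh P' = maxCHSH := by rw [← chsh_add_smul, h, chsh_PQ]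
  refine c1 (le_antisymm b1 (le_of_mul_le_mul_left ?_ hs))
  linear_combination t * b2 - h4 + maxCHSH * hst

end Class3b

theorem mainTheorem2 :
    IsGreatest (chsh '' quantumClass3b.{u}) Class3b.maxCHSH ∧
    |Class3b.maxCHSH - 2.26977| < 0.000005 ∧
    (∀ P ∈ quantumClass3b.{u}, chsh P = Class3b.maxCHSH ↔ P = Class3b.PQ) ∧
    Class3b.PQ ∈ quantumClass3b.{u} ∧
    Class3b.PQ ∈ Set.extremePoints ℝ quantumSet.{u} ∧
    SelfTests.{u} Class3b.PQ Class3b.reference ∧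
    (∀ (HA HB : Type u) [NormedAddCommGroup HA] [InnerProductSpace ℂ HA] [CompleteSpace HA]
      [NormedAddCommGroup HB] [InnerProductSpace ℂ HB] [CompleteSpace HB]
      (S : PureStrategy HA HB) (P : Correlation), S.Realizes P → HasClass3bZeros P →
      chsh P = Class3b.maxCHSH → S.EquivUpToLocalIsometries Class3b.reference) := by
  refine ⟨⟨⟨_, Class3b.PQ_mem_quantumClass3b, Class3b.chsh_PQ⟩, ?_⟩, Class3b.abs_maxCHSH_sub_lt,
    fun P hP => Class3b.chsh_eq_max_iff hP, Class3b.PQ_mem_quantumClass3b,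
    Class3b.PQ_mem_extremePoints,
    ⟨Class3b.reference_realizes, ?_⟩, ?_⟩
  · rintro _ ⟨P, hP, rfl⟩
    exact (chsh_le_and_eq_of_mem hP).1
  · intro HA HB _ _ _ _ _ _ S hS
    exact PureStrategy.equiv_reference_of_chsh_eq hS Class3b.hasClass3bZeros_PQ Class3b.chsh_PQ
  · intro HA HB _ _ _ _ _ _ S P hS h0 hc
    exact PureStrategy.equiv_reference_of_chsh_eq hS h0 hc
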